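/- Let $n\ge 1$ and let $\mathbb B^{n+1}$ be the Poincaré ball model of hyperbolic space, i.e. the open unit ball of $\mathbb R^{n+1}$ with the metric $\bar g=\frac{4}{(1-|x|^2)^2}\delta$, where $\delta$ is the Euclidean metric; let $\overline\nabla$ be its Levi-Civita connection. Put $\mathbb B^{n+1}_+=\{x\in\mathbb B^{n+1}:\delta(x,E_{n+1})\ge 0\}$, let $P=\{x\in\mathbb B^{n+1}:\delta(x,E_{n+1})=0\}$, and let $\overline N=-\frac{1-|x|^2}{2}E_{n+1}$ be the unit normal of $P$ pointing out of $\mathbb B^{n+1}_+$. **Theorem.** Let $\Sigma$ be a compact smooth $n$-dimensional manifold with boundary, let $x:\Sigma\to\mathbb B^{n+1}_+$ be a smooth immersion, and let $\nu$ be a smooth unit normal field along $x$. Assume that * (capillary, supported on $P$) $x(\operatorname{int}\Sigma)\subset\operatorname{int}\mathbb B^{n+1}_+$, $x(\partial\Sigma)\subset P$, and there is a constant $\theta\in(0,\pi)$ such that along $\partial\Sigma$ the angle between $\overline N$ and $-\nu$ equals $\theta$; * (CMC) the mean curvature $H_1=\frac1n\operatorname{tr}_g h$ is constant on $\Sigma$,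 where $g=x^*\bar g$ is the induced metric and $h(Y,Z)=\bar g(\overline\nabla_Y\nu,Z)$ is the second fundamental form; * (star-shaped) $\bar g(x,\nu)>0$ everywhere on $\Sigma$, where $x$ denotes the position vector field. Then $\Sigma$ is totally umbilical: at every point of $\Sigma$ all principal curvatures coincide, i.e. $h=\kappa\, g$ for some real number $\kappa$. -/

import Mathlib

open scoped Manifold ContDiff InnerProductSpace

noncomputable section

namespace HyperbolicCapillary

/-- The Euclidean space `ℝⁿ⁺¹` whose open unit ball carries the Poincaré metric. It is also the
space of vectors tangent to the ball at any of its points. -/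
abbrev Amb (n : ℕ) : Type := EuclideanSpace ℝ (Fin (n + 1))

/-- The hyperbolic metric `ḡ_x(u, v) = 4 / (1 - |x|²)² · δ(u, v)` of the Poincaré ball model. -/
def hypMetric {n : ℕ} (x u v : Amb n) : ℝ := 4 / (1 - ‖x‖ ^ 2) ^ 2 * ⟪u, v⟫_ℝ

/-- The Christoffel map of the Levi-Civita connection of `hypMetric`: for vector fields on the
ball, `∇̄_X Y = D_X Y + Γ_x(X, Y)` with `D` the flat derivative. That `Γ` is symmetric (no torsion)
and compatible with the metric is proved in the two lemmas below. -/
def christoffel {n : ℕ} (x u v : Amb n) : Amb n :=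
  (2 / (1 - ‖x‖ ^ 2)) • (⟪x, u⟫_ℝ • v + ⟪x, v⟫_ℝ • u - ⟪u, v⟫_ℝ • x)

theorem christoffel_symm {n : ℕ} (x u v : Amb n) : christoffel x u v = christoffel x v u := by
  unfold christoffel
  rw [real_inner_comm u v, add_comm (⟪x, u⟫_ℝ • v)]

theorem christoffel_metric {n : ℕ} (x v w u : Amb n) (hx : ‖x‖ < 1) :
    fderiv ℝ (fun y : Amb n => hypMetric y v w) x u
      = hypMetric x (christoffel x u v) w + hypMetric x v (christoffel x u w) := by
  have h0 : (1 - ‖x‖ ^ 2) ≠ 0 := by nlinarith [norm_nonneg x]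
  have h1 : HasFDerivAt (fun y : Amb n => ‖y‖ ^ 2) (2 • innerSL ℝ x) x :=
    (hasStrictFDerivAt_norm_sq x).hasFDerivAt
  have h2 := (h1.const_sub 1).pow 2
  have h3 := (hasDerivAt_inv (pow_ne_zero 2 h0)).comp_hasFDerivAt x h2
  have h4 := (h3.const_mul 4).mul_const ⟪v, w⟫_ℝ
  have h5 : (fun y : Amb n => hypMetric y v w) = fun y : Amb n =>
      4 * ((fun t : ℝ => t⁻¹) ∘ fun z : Amb n => (1 - ‖z‖ ^ 2) ^ 2) y * ⟪v, w⟫_ℝ := by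
    funext y
    simp [hypMetric, div_eq_mul_inv]
  rw [h5, HasFDerivAt.fderiv h4]
  simp only [hypMetric, christoffel, inner_smul_left, inner_smul_right, inner_add_left,
    inner_add_right, inner_sub_left, inner_sub_right, smul_apply,
    neg_apply, innerSL_apply_apply, smul_eq_mul, RCLike.conj_to_real]
  rw [real_inner_comm v u, real_inner_comm v x]
  simp
  field_simp
  ring

/-- The unit vector `E_{n+1}`. -/
def lastVec (n : ℕ) : Amb n := EuclideanSpace.single (Fin.last n) 1

/-- The half ball `𝔹ⁿ⁺¹₊ = {x ∈ 𝔹ⁿ⁺¹ : δ(x, E_{n+1}) ≥ 0}`. -/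
def halfBall (n : ℕ) : Set (Amb n) := {x | ‖x‖ < 1 ∧ 0 ≤ ⟪x, lastVec n⟫_ℝ}

/-- The interior of the half ball as a manifold with boundary. -/
def halfBallInterior (n : ℕ) : Set (Amb n) := {x | ‖x‖ < 1 ∧ 0 < ⟪x, lastVec n⟫_ℝ}

/-- The totally geodesic hyperplane `P = {x ∈ 𝔹ⁿ⁺¹ : δ(x, E_{n+1}) = 0}`. -/
def supportPlane (n : ℕ) : Set (Amb n) := {x | ‖x‖ < 1 ∧ ⟪x, lastVec n⟫_ℝ = 0}

/-- The unit normal `N̄ = -((1 - |x|²) / 2) E_{n+1}` of `P` that points out of the half ball. -/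
def supportNormal {n : ℕ} (x : Amb n) : Amb n := (-((1 - ‖x‖ ^ 2) / 2)) • lastVec n

section Hypersurface

variable {n : ℕ} [NeZero n] {M : Type*} [TopologicalSpace M] [ChartedSpace (EuclideanHalfSpace n) M]

/-- The differential `dX_p : T_p M → ℝⁿ⁺¹` of a map `X` from a manifold with boundary. -/
def diff (X : M → Amb n) (p : M) : TangentSpace (𝓡∂ n) p →L[ℝ] Amb n :=
  mfderiv (𝓡∂ n) 𝓘(ℝ, Amb n) X p

/-- `X` is a smooth immersion of the manifold with boundary `M` into the half ball. -/
structure IsImmersedInHalfBall (X : M → Amb n) : Prop where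
  smooth : ContMDiff (𝓡∂ n) 𝓘(ℝ, Amb n) ∞ X
  injective_diff : ∀ p, Function.Injective (diff X p)
  mem_halfBall : ∀ p, X p ∈ halfBall n

/-- `ν` is a smooth unit normal field, for the hyperbolic metric, along `X`. -/
structure IsUnitNormal (X ν : M → Amb n) : Prop where
  smooth : ContMDiff (𝓡∂ n) 𝓘(ℝ, Amb n) ∞ ν
  orthogonal : ∀ p (v : TangentSpace (𝓡∂ n) p), hypMetric (X p) (ν p) (diff X p v) = 0
  unit : ∀ p, hypMetric (X p) (ν p) (ν p) = 1

/-- The capillary condition along `P`: interior points go to the interior of the half ball,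
boundary points go to `P`, and along the boundary the angle (in the hyperbolic metric) between
`N̄` and `-ν` is the constant `θ ∈ (0, π)`. -/
structure IsCapillary (X ν : M → Amb n) (θ : ℝ) : Prop where
  angle_mem : θ ∈ Set.Ioo 0 Real.pi
  map_interior : ∀ p ∈ (𝓡∂ n).interior M, X p ∈ halfBallInterior n
  map_boundary : ∀ p ∈ (𝓡∂ n).boundary M, X p ∈ supportPlane n
  contact_angle : ∀ p ∈ (𝓡∂ n).boundary M,
    hypMetric (X p) (supportNormal (X p)) (-ν p) = Real.cos θ

/-- The induced metric `g = X^* ḡ` on `M`. -/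
def inducedMetric (X : M → Amb n) (p : M) (v w : TangentSpace (𝓡∂ n) p) : ℝ :=
  hypMetric (X p) (diff X p v) (diff X p w)

/-- The Levi-Civita derivative `∇̄_v Z` of a vector field `Z` along `X`. -/
def covDeriv (X Z : M → Amb n) (p : M) (v : TangentSpace (𝓡∂ n) p) : Amb n :=
  diff Z p v + christoffel (X p) (diff X p v) (Z p)

/-- The second fundamental form `h(v, w) = ḡ(∇̄_v ν, w)`. -/
def secondFundamentalForm (X ν : M → Amb n) (p : M) (v w : TangentSpace (𝓡∂ n) p) : ℝ :=
  hypMetric (X p) (covDeriv X ν p v) (diff X p w)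

/-- The `i`-th vector of the coordinate basis of `T_p M`. -/
def coordVec (p : M) (i : Fin n) : TangentSpace (𝓡∂ n) p :=
  (EuclideanSpace.single i 1 : EuclideanSpace ℝ (Fin n))

/-- The normalized mean curvature `H₁ = (1/n) gⁱʲ hᵢⱼ`, that is, the arithmetic mean of the
principal curvatures (the trace of `g⁻¹ h` does not depend on the basis of `T_p M`). -/
def meanCurvature (X ν : M → Amb n) (p : M) : ℝ :=
  (1 / (n : ℝ)) * Matrix.trace
    ((Matrix.of fun i j => inducedMetric X p (coordVec p i) (coordVec p j))⁻¹ *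
      (Matrix.of fun i j => secondFundamentalForm X ν p (coordVec p i) (coordVec p j)))

/-- The mean curvature is the same constant at all points. -/
def IsCMC (X ν : M → Amb n) : Prop := ∃ H : ℝ, ∀ p, meanCurvature X ν p = H

/-- `X` is star-shaped (about the origin) with respect to `ν`: `ḡ(x, ν) > 0` everywhere, where `x`
is the position vector field `sinh r ∂_r`. -/
def IsStarShaped (X ν : M → Amb n) : Prop := ∀ p, 0 < hypMetric (X p) (X p) (ν p)

/-- At every point all principal curvatures are equal, that is, `h = κ g`. -/
def IsTotallyUmbilical (X ν : M → Amb n) : Prop :=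
  ∀ p, ∃ κ : ℝ, ∀ v w : TangentSpace (𝓡∂ n) p,
    secondFundamentalForm X ν p v w = κ * inducedMetric X p v w

end Hypersurface

end HyperbolicCapillary

end

/-! The proof takes place in the hyperboloid model. The isometry `hypLift` carries the hypersurface
and its normal to maps `x` and `ν` into Minkowski space, where the Levi-Civita connection becomes
flat differentiation up to multiples of `x` (`hasFDerivAt_vecLift`). With `B = dx` and `C = dν`, the
Weingarten equation reads `C = B ∘ A` for the shape operator `A`. Star-shapedness says that the time
component `u` of `ν` is positive, and the capillary condition says that `x` is orthogonal to a fixed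
spacelike vector `e_s` along the boundary while `⟨ν, e_s⟩ = cos θ` there.

Let `Y = -(1 - cos θ ⟨ν, e_s⟩) e₀ + cos θ u e_s` (`capVec`), where `e₀` is the time direction, let
`T` be the tangential part of `Y`, and let `W = (A - H) T` (`flowField`), with `H` the constant mean
curvature. Three facts carry the proof.

* The divergence of `W` is `-u |A - H|²` (`divergence_flowField`). By the Codazzi equation and the
  constancy of `H` it is the trace of `A - H` composed with the covariant derivative of `T`. Now
  `⟨ν, Y⟩ = u`, so this derivative is a multiple of the identity, minus `u A`, plus the tangential
  part of `dY`. The multiple of the identity is killed because `A - H` is traceless, and `dY`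
  contributes nothing because `A` is symmetric (`IsAdapted₂.traceL_capVec`).
* `W` is tangent to the boundary (`IsCapillaryHypersurface.chartFlow_boundary`). Along the boundary
  `T` is orthogonal to `e_s`, hence tangent to the boundary, and `⟨ν, e_s⟩` is constant there, so
  `A T` is orthogonal to `e_s` as well.
* The divergence theorem then gives `∫ u |A - H|² = 0`. It is proved chart by chart: the fields
  `f W`, with `f` from a partition of unity, are integrated against the density of the chart
  (`IsCapillaryHypersurface.chartIntegral_flow`), and the integrals in different charts are compared
  by the change of variables formula (`IsHypersurface.chartIntegral_eq`).

As `u > 0` and `|A - H|² ≥ 0`, the operator `A - H` vanishes everywhere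
(`IsCapillaryHypersurface.traceless_eq_zero`), which is umbilicity.
-/

section

open scoped Manifold ContDiff InnerProductSpace
open Set Filter Topology MeasureTheory

noncomputable section

namespace HyperbolicCapillary


/-! ### Traces and the derivative of the determinant -/

section TraceDet

variable {G : Type*} [NormedAddCommGroup G] [NormedSpace ℝ G] [FiniteDimensional ℝ G]
  {G' : Type*} [NormedAddCommGroup G'] [NormedSpace ℝ G'] [FiniteDimensional ℝ G']

/-- The trace of an endomorphism of a finite-dimensional normed space, as a continuous linear
functional. -/
def traceL (G : Type*) [NormedAddCommGroup G] [NormedSpace ℝ G] [FiniteDimensional ℝ G] :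
    (G →L[ℝ] G) →L[ℝ] ℝ :=
  LinearMap.toContinuousLinearMap
    ((LinearMap.trace ℝ G) ∘ₗ (ContinuousLinearMap.coeLM ℝ : (G →L[ℝ] G) →ₗ[ℝ] G →ₗ[ℝ] G))

theorem traceL_apply (f : G →L[ℝ] G) : traceL G f = LinearMap.trace ℝ G f.toLinearMap := rfl

theorem traceL_comp_comm (f : G →L[ℝ] G') (g : G' →L[ℝ] G) :
    traceL G (g ∘L f) = traceL G' (f ∘L g) := by
  simp only [traceL_apply, ContinuousLinearMap.toLinearMap_comp]
  exact LinearMap.trace_comp_comm' _ _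

theorem traceL_prod (R : G × G' →L[ℝ] G × G') :
    traceL (G × G') R =
      traceL G (ContinuousLinearMap.fst ℝ G G' ∘L R ∘L ContinuousLinearMap.inl ℝ G G') +
      traceL G' (ContinuousLinearMap.snd ℝ G G' ∘L R ∘L ContinuousLinearMap.inr ℝ G G') := by
  have h : R = (R ∘L ContinuousLinearMap.inl ℝ G G') ∘L ContinuousLinearMap.fst ℝ G G' +
      (R ∘L ContinuousLinearMap.inr ℝ G G') ∘L ContinuousLinearMap.snd ℝ G G' := by
    ext x <;> simp [ContinuousLinearMap.map_zero]
  conv_lhs => rw [h]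
  rw [map_add, traceL_comp_comm (ContinuousLinearMap.fst ℝ G G'),
    traceL_comp_comm (ContinuousLinearMap.snd ℝ G G')]

theorem traceL_real (f : ℝ →L[ℝ] ℝ) : traceL ℝ f = f 1 := by
  rw [traceL_apply, LinearMap.trace_eq_matrix_trace ℝ (Module.Basis.singleton Unit ℝ)]
  simp [Matrix.trace, LinearMap.toMatrix_apply]

theorem traceL_smulRight (l : G →L[ℝ] ℝ) (v : G) :
    traceL G (l.smulRight v) = l v := by
  have : l.smulRight v = (ContinuousLinearMap.toSpanSingleton ℝ v) ∘L l := by ext; simp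
  rw [this, traceL_comp_comm, traceL_real]
  simp

theorem traceL_id : traceL G (ContinuousLinearMap.id ℝ G) = Module.finrank ℝ G := by
  rw [traceL_apply]
  simp

theorem traceL_euclidean {n : ℕ} (f : EuclideanSpace ℝ (Fin n) →L[ℝ] EuclideanSpace ℝ (Fin n)) :
    traceL _ f = ∑ i, f (EuclideanSpace.single i 1) i := by
  rw [traceL_apply, LinearMap.trace_eq_matrix_trace ℝ (EuclideanSpace.basisFun (Fin n) ℝ).toBasis]
  simp [Matrix.trace, LinearMap.toMatrix_apply]

/-- The derivative of the determinant at the identity is the trace. -/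
theorem hasFDerivAt_det_id :
    HasFDerivAt (fun S : G →L[ℝ] G => S.det) (traceL G) (ContinuousLinearMap.id ℝ G) := by
  let b := Module.finBasis ℝ G
  let m : Fin (Module.finrank ℝ G) → Fin (Module.finrank ℝ G) → (G →L[ℝ] G) →L[ℝ] ℝ :=
    fun i j => LinearMap.toContinuousLinearMap
      { toFun := fun S => LinearMap.toMatrix b b S.toLinearMap i j
        map_add' := by intro x y; simp
        map_smul' := by intro x y; simp }
  have hd : (fun S : G →L[ℝ] G => S.det) = fun S => ∑ σ : Equiv.Perm (Fin (Module.finrank ℝ G)),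
      (Equiv.Perm.sign σ : ℝ) * ∏ i, m (σ i) i S := by
    funext S
    refine (LinearMap.det_toMatrix b S.toLinearMap).symm.trans ?_
    rw [Matrix.det_apply']
    rfl
  have h1 : DifferentiableAt ℝ (fun S : G →L[ℝ] G => S.det) (ContinuousLinearMap.id ℝ G) := by
    rw [hd]
    fun_prop
  convert h1.hasFDerivAt using 1
  ext S
  have h2 : HasDerivAt (fun t : ℝ => (ContinuousLinearMap.id ℝ G + t • S).det)
      (fderiv ℝ (fun S : G →L[ℝ] G => S.det) (ContinuousLinearMap.id ℝ G) S) 0 := by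
    have h3 : HasDerivAt (fun t : ℝ => ContinuousLinearMap.id ℝ G + t • S) S 0 := by
      simpa using ((hasDerivAt_id (0 : ℝ)).smul_const S).const_add (ContinuousLinearMap.id ℝ G)
    have h4 : HasFDerivAt (fun S : G →L[ℝ] G => S.det)
        (fderiv ℝ (fun S : G →L[ℝ] G => S.det) (ContinuousLinearMap.id ℝ G))
        (ContinuousLinearMap.id ℝ G + (0 : ℝ) • S) := by
      simpa using h1.hasFDerivAt
    exact h4.comp_hasDerivAt 0 h3
  refine HasDerivAt.unique ?_ h2
  let N := LinearMap.toMatrix b b S.toLinearMap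
  have h5 (t : ℝ) : (ContinuousLinearMap.id ℝ G + t • S).det = 1 + N.trace * t +
      (Matrix.det (1 + (Polynomial.X : Polynomial ℝ) • N.map Polynomial.C)).divX.divX.eval t
        * t ^ 2 := by
    rw [← Matrix.det_one_add_smul]
    change LinearMap.det _ = _
    rw [← LinearMap.det_toMatrix b]
    congr 1
    simp [N]
  simp only [h5]
  have h6 : traceL G S = N.trace := by
    rw [traceL_apply, LinearMap.trace_eq_matrix_trace ℝ b]
  rw [h6]
  set q := (Matrix.det (1 + (Polynomial.X : Polynomial ℝ) • N.map Polynomial.C)).divX.divX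
  have h7 := (((hasDerivAt_id (0 : ℝ)).const_mul N.trace).const_add 1).add
    ((q.hasDerivAt 0).mul ((hasDerivAt_id (0 : ℝ)).pow 2))
  convert! h7 using 1
  simp

/-- **Jacobi's formula**: the logarithmic derivative of `|det Θ|` is the trace of `Θ⁻¹ Θ'`. -/
theorem hasFDerivAt_abs_det {W : Type*} [NormedAddCommGroup W] [NormedSpace ℝ W]
    {Θ : W → G →L[ℝ] G} {Θ' : W →L[ℝ] G →L[ℝ] G} {y : W} {e : G ≃L[ℝ] G}
    (he : Θ y = e) (h : HasFDerivAt Θ Θ' y) :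
    HasFDerivAt (fun z => |(Θ z).det|)
      (|(Θ y).det| • (traceL G ∘L
        (ContinuousLinearMap.compL ℝ G G G (e.symm : G →L[ℝ] G)) ∘L Θ')) y := by
  have h0 : (Θ y).det ≠ 0 := by
    rw [he]; exact (LinearEquiv.isUnit_det' e.toLinearEquiv).ne_zero
  have h1 : (fun z => (Θ z).det) = fun z => (Θ y).det * ((e.symm : G →L[ℝ] G) ∘L Θ z).det := by
    funext z
    have : Θ z = (e : G →L[ℝ] G) ∘L ((e.symm : G →L[ℝ] G) ∘L Θ z) := by ext; simp
    conv_lhs => rw [this]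
    rw [he]
    exact LinearMap.det_comp _ _
  have h2 : HasFDerivAt (fun z => (e.symm : G →L[ℝ] G) ∘L Θ z)
      ((ContinuousLinearMap.compL ℝ G G G (e.symm : G →L[ℝ] G)) ∘L Θ') y :=
    (ContinuousLinearMap.compL ℝ G G G (e.symm : G →L[ℝ] G)).hasFDerivAt.comp y h
  have h3 : HasFDerivAt (fun S : G →L[ℝ] G => S.det) (traceL G)
      ((e.symm : G →L[ℝ] G) ∘L Θ y) := by
    have : (e.symm : G →L[ℝ] G) ∘L Θ y = ContinuousLinearMap.id ℝ G := by rw [he]; ext; simp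
    rw [this]; exact hasFDerivAt_det_id
  have h4 : HasFDerivAt (fun z => (Θ z).det) ((Θ y).det • (traceL G ∘L
      (ContinuousLinearMap.compL ℝ G G G (e.symm : G →L[ℝ] G)) ∘L Θ')) y := by
    rw [h1]
    exact (h3.comp y h2).const_mul _
  rcases lt_or_gt_of_ne h0 with h5 | h5
  · convert! h4.abs_of_neg h5 using 1
    rw [abs_of_neg h5]
    ext v
    simp
  · convert! h4.abs_of_pos h5 using 1
    rw [abs_of_pos h5]

end TraceDet


/-! ### Frames in Minkowski space -/

/-- Minkowski space `ℝ × ℝⁿ⁺¹`, whose unit hyperboloid is the second model of hyperbolic space used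
here; the first coordinate is the time. -/
abbrev Mink (n : ℕ) : Type := ℝ × Amb n

/-- The space on which the charts of an `n`-dimensional manifold with boundary are modelled. -/
abbrev Coord (n : ℕ) : Type := EuclideanSpace ℝ (Fin n)

section Frame

variable {n : ℕ}

/-- The Lorentz form `⟨a, b⟩ = ⟨a₂, b₂⟩ - a₁ b₁` of Minkowski space. -/
def lor : Mink n →L[ℝ] Mink n →L[ℝ] ℝ :=
  ((isBoundedBilinearMap_inner (𝕜 := ℝ) (E := Amb n)).toContinuousLinearMap).bilinearComp
      (ContinuousLinearMap.snd ℝ ℝ (Amb n)) (ContinuousLinearMap.snd ℝ ℝ (Amb n))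
    - (ContinuousLinearMap.mul ℝ ℝ).bilinearComp (ContinuousLinearMap.fst ℝ ℝ (Amb n))
      (ContinuousLinearMap.fst ℝ ℝ (Amb n))

theorem lor_apply (a b : Mink n) : lor a b = ⟪a.2, b.2⟫_ℝ - a.1 * b.1 := by
  simp [lor]

theorem lor_comm (a b : Mink n) : lor a b = lor b a := by
  rw [lor_apply, lor_apply, real_inner_comm, mul_comm]

/-- The reverse Cauchy–Schwarz inequality: the orthogonal complement of a unit timelike vector is
spacelike. -/
theorem lor_self_pos {x z : Mink n} (hx : lor x x = -1) (hxz : lor x z = 0) (hz : z ≠ 0) :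
    0 < lor z z := by
  rw [lor_apply, real_inner_self_eq_norm_sq] at *
  have h1 : ⟪x.2, z.2⟫_ℝ ^ 2 ≤ ‖x.2‖ ^ 2 * ‖z.2‖ ^ 2 := by
    have h := abs_real_inner_le_norm x.2 z.2
    rw [← sq_abs, ← mul_pow]
    gcongr
  have h2 : ⟪x.2, z.2⟫_ℝ = x.1 * z.1 := by linarith
  have h3 : ‖x.2‖ ^ 2 = x.1 ^ 2 - 1 := by linarith
  rw [h2, h3] at h1
  by_cases h4 : ‖z.2‖ = 0
  · exfalso
    apply hz
    have h5 : z.2 = 0 := norm_eq_zero.1 h4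
    rw [h4] at h1
    have h6 : x.1 ≠ 0 := by intro h; rw [h] at h3; nlinarith [sq_nonneg ‖x.2‖]
    have h7 : x.1 * z.1 = 0 := by nlinarith [sq_nonneg (x.1 * z.1)]
    have h8 : z.1 = 0 := (mul_eq_zero.1 h7).resolve_left h6
    exact Prod.ext h8 h5
  · have h5 : 0 < ‖z.2‖ ^ 2 := by positivity
    have h6 : 0 < x.1 ^ 2 * (‖z.2‖ ^ 2 - z.1 ^ 2) := by nlinarith
    have h7 := (pos_iff_pos_of_mul_pos h6).1 (by nlinarith [sq_nonneg ‖x.2‖])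
    nlinarith

/-- The linear map `(α, β, v) ↦ α x + β ν + B v`. When `x` is a point of a hypersurface of the
hyperboloid, `ν` its normal and `B` the derivative of a parametrization, it expresses Minkowski
vectors in the adapted frame. -/
def frameMap (x ν : Mink n) (B : Coord n →L[ℝ] Mink n) : (ℝ × ℝ × Coord n) →L[ℝ] Mink n :=
  (ContinuousLinearMap.toSpanSingleton ℝ x).coprod
    ((ContinuousLinearMap.toSpanSingleton ℝ ν).coprod B)

theorem frameMap_apply (x ν : Mink n) (B : Coord n →L[ℝ] Mink n) (w : ℝ × ℝ × Coord n) :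
    frameMap x ν B w = w.1 • x + (w.2.1 • ν + B w.2.2) := by
  simp [frameMap]

/-- The first-order data of a hypersurface of the hyperboloid at a point: `x` lies on the
hyperboloid, `ν` is a unit normal and `B` is injective with values tangent to the hyperboloid and
orthogonal to `ν`. -/
structure IsAdapted (x ν : Mink n) (B : Coord n →L[ℝ] Mink n) : Prop where
  lor_x : lor x x = -1
  lor_ν : lor ν ν = 1
  lor_xν : lor x ν = 0
  lor_xB : ∀ v, lor x (B v) = 0
  lor_νB : ∀ v, lor ν (B v) = 0
  inj : Function.Injective B

/-- The component, in the frame `x, ν, B`, of a vector along `B`. For adapted data this is the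
orthogonal projection to the tangent space of the hypersurface. -/
def tangProj (x ν : Mink n) (B : Coord n →L[ℝ] Mink n) : Mink n →L[ℝ] Coord n :=
  (ContinuousLinearMap.snd ℝ ℝ (Coord n)) ∘L (ContinuousLinearMap.snd ℝ ℝ (ℝ × Coord n)) ∘L
    (frameMap x ν B).inverse

/-- The shape operator, where `C` is the derivative of the normal. -/
def shape (x ν : Mink n) (B C : Coord n →L[ℝ] Mink n) : Coord n →L[ℝ] Coord n :=
  tangProj x ν B ∘L C

/-- The shape operator minus `H` times the identity; it is the traceless part if `H` is the mean
curvature. -/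
def traceless (H : ℝ) (x ν : Mink n) (B C : Coord n →L[ℝ] Mink n) : Coord n →L[ℝ] Coord n :=
  shape x ν B C - H • ContinuousLinearMap.id ℝ (Coord n)

/-- The squared norm of the traceless second fundamental form. -/
def umbilicity (H : ℝ) (x ν : Mink n) (B C : Coord n →L[ℝ] Mink n) : ℝ :=
  traceL (Coord n) (traceless H x ν B C ∘L traceless H x ν B C)

/-- The time direction. -/
def timeVec (n : ℕ) : Mink n := (1, 0)

/-- The direction orthogonal to the hyperplane that supports the boundary. -/
def sideVec (n : ℕ) : Mink n := (0, lastVec n)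

/-- The Minkowski vector `-(1 - cos θ · c) e₀ + cos θ · u · e_s`, where `u` and `c` are the
components of `ν` in the time direction `e₀` and the side direction `e_s`. Its tangential part is
the vector field that is tangent to the boundary of a capillary hypersurface with contact
angle `θ`. -/
def capVec (θ : ℝ) (ν : Mink n) : Mink n :=
  (-(1 - Real.cos θ * lor ν (sideVec n))) • timeVec n + (Real.cos θ * ν.1) • sideVec n

/-- The tangential part of `capVec`. -/
def capField (θ : ℝ) (x ν : Mink n) (B : Coord n →L[ℝ] Mink n) : Coord n :=
  tangProj x ν B (capVec θ ν)

/-- The traceless shape operator applied to `capField`. -/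
def flowField (θ H : ℝ) (x ν : Mink n) (B C : Coord n →L[ℝ] Mink n) : Coord n :=
  traceless H x ν B C (capField θ x ν B)

theorem lor_timeVec (a : Mink n) : lor a (timeVec n) = -a.1 := by simp [lor_apply, timeVec]

theorem lor_timeVec_sideVec : lor (timeVec n) (sideVec n) = 0 := by
  simp [lor_apply, timeVec, sideVec]

theorem lor_sideVec_self : lor (sideVec n) (sideVec n) = 1 := by
  simp [lor_apply, sideVec, lastVec]

/-- A fixed identification of Minkowski space with the coordinate space of frames; it only serves
to take determinants. -/
def minkEquiv (n : ℕ) : Mink n ≃L[ℝ] (ℝ × ℝ × Coord n) :=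
  ContinuousLinearEquiv.ofFinrankEq (by simp; ring)

/-- The volume density of a hypersurface, up to a constant factor. It is the determinant of the
whole frame: as `x` and `ν` are unit vectors orthogonal to each other and to the range of `B`,
they contribute the factor one to the Lorentzian volume. -/
def density (x ν : Mink n) (B : Coord n →L[ℝ] Mink n) : ℝ :=
  |((minkEquiv n : Mink n →L[ℝ] (ℝ × ℝ × Coord n)) ∘L frameMap x ν B).det|

variable {x ν : Mink n} {B C : Coord n →L[ℝ] Mink n}

theorem IsAdapted.isInvertible (h : IsAdapted x ν B) : (frameMap x ν B).IsInvertible := by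
  have hinj : Function.Injective (frameMap x ν B) := by
    rw [injective_iff_map_eq_zero]
    rintro ⟨α, β, v⟩ hw
    rw [frameMap_apply] at hw
    have h1 := congrArg (lor x) hw
    have h2 := congrArg (lor ν) hw
    simp [h.lor_x, h.lor_xν, h.lor_xB] at h1
    simp [h.lor_ν, h.lor_νB, lor_comm ν x, h.lor_xν] at h2
    subst h1 h2
    have h3 : B v = 0 := by simpa using hw
    have h4 : v = 0 := h.inj (by simpa using h3)
    simp [h4]
  have hfr : Module.finrank ℝ (ℝ × ℝ × Coord n) = Module.finrank ℝ (Mink n) :=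
    (minkEquiv n).symm.toLinearEquiv.finrank_eq
  refine ⟨(LinearEquiv.ofInjectiveOfFinrankEq (frameMap x ν B).toLinearMap hinj
    hfr).toContinuousLinearEquiv, ?_⟩
  apply ContinuousLinearMap.ext
  intro w
  rfl

theorem tangProj_frameMap (h : (frameMap x ν B).IsInvertible) (α β : ℝ) (v : Coord n) :
    tangProj x ν B (α • x + (β • ν + B v)) = v := by
  have h1 : α • x + (β • ν + B v) = frameMap x ν B (α, β, v) := by rw [frameMap_apply]
  rw [h1, tangProj]
  simp [h.inverse_apply_self]

theorem tangProj_x (h : (frameMap x ν B).IsInvertible) : tangProj x ν B x = 0 := by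
  simpa using tangProj_frameMap h 1 0 0

theorem tangProj_ν (h : (frameMap x ν B).IsInvertible) : tangProj x ν B ν = 0 := by
  simpa using tangProj_frameMap h 0 1 0

theorem tangProj_B (h : (frameMap x ν B).IsInvertible) (v : Coord n) :
    tangProj x ν B (B v) = v := by
  simpa using tangProj_frameMap h 0 0 v

theorem exists_frame_decomp (h : (frameMap x ν B).IsInvertible) (z : Mink n) :
    ∃ α β : ℝ, z = α • x + (β • ν + B (tangProj x ν B z)) := by
  refine ⟨((frameMap x ν B).inverse z).1, ((frameMap x ν B).inverse z).2.1, ?_⟩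
  have h1 := h.self_apply_inverse z
  rw [frameMap_apply] at h1
  exact h1.symm

theorem IsAdapted.B_tangProj (h : IsAdapted x ν B) (z : Mink n) :
    B (tangProj x ν B z) = z + lor x z • x - lor ν z • ν := by
  obtain ⟨α, β, hz⟩ := exists_frame_decomp h.isInvertible z
  have h1 : lor x z = -α := by
    rw [hz]; simp [h.lor_x, h.lor_xν, h.lor_xB]
  have h2 : lor ν z = β := by
    rw [hz]; simp [h.lor_ν, h.lor_νB, lor_comm ν x, h.lor_xν]
  rw [h1, h2]
  conv_rhs => rw [hz]
  module

/-- Tangential vectors see the orthogonal projection through the metric. -/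
theorem IsAdapted.lor_B_tangProj (h : IsAdapted x ν B) (v : Coord n) (z : Mink n) :
    lor (B v) (B (tangProj x ν B z)) = lor (B v) z := by
  rw [h.B_tangProj]
  simp [lor_comm (B v) x, lor_comm (B v) ν, h.lor_xB, h.lor_νB]

theorem IsAdapted.C_eq (h : IsAdapted x ν B) (h1 : ∀ v, lor x (C v) = 0)
    (h2 : ∀ v, lor ν (C v) = 0) (v : Coord n) : C v = B (shape x ν B C v) := by
  simp [shape, h.B_tangProj, h1, h2]

theorem IsAdapted.lor_B_pos (h : IsAdapted x ν B) {v : Coord n} (hv : v ≠ 0) :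
    0 < lor (B v) (B v) := by
  refine lor_self_pos h.lor_x (h.lor_xB v) fun h0 => hv (h.inj ?_)
  simpa using h0

section Naturality

variable (L : Coord n ≃L[ℝ] Coord n)

theorem frameMap_comp : frameMap x ν (B ∘L (L : Coord n →L[ℝ] Coord n)) = frameMap x ν B ∘L
    (((ContinuousLinearEquiv.refl ℝ ℝ).prodCongr ((ContinuousLinearEquiv.refl ℝ ℝ).prodCongr L) :
      (ℝ × ℝ × Coord n) ≃L[ℝ] (ℝ × ℝ × Coord n)) : (ℝ × ℝ × Coord n) →L[ℝ] (ℝ × ℝ × Coord n)) := by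
  apply ContinuousLinearMap.ext
  intro w
  simp [frameMap_apply]

theorem IsAdapted.comp (h : IsAdapted x ν B) :
    IsAdapted x ν (B ∘L (L : Coord n →L[ℝ] Coord n)) where
  lor_x := h.lor_x
  lor_ν := h.lor_ν
  lor_xν := h.lor_xν
  lor_xB _ := h.lor_xB _
  lor_νB _ := h.lor_νB _
  inj := h.inj.comp L.injective

theorem tangProj_comp (h : (frameMap x ν B).IsInvertible) (z : Mink n) :
    tangProj x ν (B ∘L (L : Coord n →L[ℝ] Coord n)) z = L.symm (tangProj x ν B z) := by
  have h' : (frameMap x ν (B ∘L (L : Coord n →L[ℝ] Coord n))).IsInvertible := by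
    rw [frameMap_comp]
    exact h.comp ⟨_, rfl⟩
  obtain ⟨α, β, hz⟩ := exists_frame_decomp h z
  have h2 := tangProj_frameMap h' α β (L.symm (tangProj x ν B z))
  simp only [ContinuousLinearMap.comp_apply, ContinuousLinearEquiv.coe_coe,
    ContinuousLinearEquiv.apply_symm_apply] at h2
  rwa [← hz] at h2

theorem shape_comp (h : (frameMap x ν B).IsInvertible) (v : Coord n) :
    shape x ν (B ∘L (L : Coord n →L[ℝ] Coord n)) (C ∘L (L : Coord n →L[ℝ] Coord n)) v =
      L.symm (shape x ν B C (L v)) := by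
  simp [shape, tangProj_comp L h]

theorem traceless_comp (H : ℝ) (h : (frameMap x ν B).IsInvertible) (v : Coord n) :
    traceless H x ν (B ∘L (L : Coord n →L[ℝ] Coord n)) (C ∘L (L : Coord n →L[ℝ] Coord n)) v =
      L.symm (traceless H x ν B C (L v)) := by
  simp [traceless, shape_comp L h]

theorem traceL_shape_comp (h : (frameMap x ν B).IsInvertible) :
    traceL _ (shape x ν (B ∘L (L : Coord n →L[ℝ] Coord n)) (C ∘L (L : Coord n →L[ℝ] Coord n))) =
      traceL _ (shape x ν B C) := by
  have h1 : shape x ν (B ∘L (L : Coord n →L[ℝ] Coord n)) (C ∘L (L : Coord n →L[ℝ] Coord n)) =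
      (L.symm : Coord n →L[ℝ] Coord n) ∘L (shape x ν B C ∘L (L : Coord n →L[ℝ] Coord n)) := by
    ext1 v; rw [shape_comp L h]; rfl
  rw [h1, traceL_comp_comm]
  congr 1
  ext1 v
  simp

theorem umbilicity_comp (H : ℝ) (h : (frameMap x ν B).IsInvertible) :
    umbilicity H x ν (B ∘L (L : Coord n →L[ℝ] Coord n)) (C ∘L (L : Coord n →L[ℝ] Coord n)) =
      umbilicity H x ν B C := by
  have h1 : traceless H x ν (B ∘L (L : Coord n →L[ℝ] Coord n))
      (C ∘L (L : Coord n →L[ℝ] Coord n)) ∘L traceless H x ν (B ∘L (L : Coord n →L[ℝ] Coord n))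
        (C ∘L (L : Coord n →L[ℝ] Coord n)) =
      (L.symm : Coord n →L[ℝ] Coord n) ∘L
        (traceless H x ν B C ∘L traceless H x ν B C ∘L (L : Coord n →L[ℝ] Coord n)) := by
    ext1 v
    simp [traceless_comp L H h]
  rw [umbilicity, h1, traceL_comp_comm, umbilicity]
  congr 1
  ext1 v
  simp

theorem flowField_comp (θ H : ℝ) (h : (frameMap x ν B).IsInvertible) :
    flowField θ H x ν (B ∘L (L : Coord n →L[ℝ] Coord n)) (C ∘L (L : Coord n →L[ℝ] Coord n)) =
      L.symm (flowField θ H x ν B C) := by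
  simp [flowField, capField, traceless_comp L H h, tangProj_comp L h]

end Naturality

theorem density_comp (L : Coord n →L[ℝ] Coord n) :
    density x ν (B ∘L L) = |L.det| * density x ν B := by
  have h1 : (minkEquiv n : Mink n →L[ℝ] (ℝ × ℝ × Coord n)) ∘L frameMap x ν (B ∘L L) =
      ((minkEquiv n : Mink n →L[ℝ] (ℝ × ℝ × Coord n)) ∘L frameMap x ν B) ∘L
        ((ContinuousLinearMap.id ℝ ℝ).prodMap ((ContinuousLinearMap.id ℝ ℝ).prodMap L)) := by
    apply ContinuousLinearMap.ext
    intro w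
    simp [frameMap_apply]
  rw [density, h1, density, mul_comm, ← abs_mul]
  congr 1
  refine (LinearMap.det_comp _ _).trans ?_
  congr 1
  change LinearMap.det (LinearMap.prodMap (LinearMap.id : ℝ →ₗ[ℝ] ℝ)
    (LinearMap.prodMap (LinearMap.id : ℝ →ₗ[ℝ] ℝ) L.toLinearMap)) = LinearMap.det L.toLinearMap
  rw [LinearMap.det_prodMap, LinearMap.det_prodMap]
  simp

theorem density_pos (h : (frameMap x ν B).IsInvertible) : 0 < density x ν B := by
  obtain ⟨e, he⟩ := h
  rw [density, abs_pos, ← he]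
  exact (LinearEquiv.isUnit_det' (e.trans (minkEquiv n)).toLinearEquiv).ne_zero

/-! ### Pointwise consequences of the symmetry of the second fundamental form -/

/-- A self-adjoint operator whose square has zero trace vanishes; here self-adjointness refers to
the first fundamental form. -/
theorem traceL_sq_nonneg_and_eq_zero (h : IsAdapted x ν B) {S : Coord n →L[ℝ] Coord n}
    (hS : ∀ v w, lor (B (S v)) (B w) = lor (B v) (B (S w))) :
    0 ≤ traceL _ (S ∘L S) ∧ (traceL _ (S ∘L S) = 0 → S = 0) := by
  let g : LinearMap.BilinForm ℝ (Coord n) :=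
    LinearMap.mk₂ ℝ (fun v w => lor (B v) (B w)) (by simp) (by simp) (by simp) (by simp)
  have hg : ∀ v w, g v w = lor (B v) (B w) := fun _ _ => rfl
  have hsymm : LinearMap.IsSymm g := ⟨fun v w => by simp [hg, lor_comm]⟩
  obtain ⟨b, hb⟩ := LinearMap.BilinForm.exists_orthogonal_basis (B := g) hsymm
  have hpos : ∀ i, 0 < g (b i) (b i) := fun i => h.lor_B_pos (b.ne_zero i)
  have hcoef : ∀ i z, g z (b i) = b.repr z i * g (b i) (b i) := by
    intro i z
    conv_lhs => rw [← b.sum_repr z]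
    rw [map_sum, LinearMap.sum_apply, Finset.sum_eq_single i]
    · simp
    · intro j _ hj
      have : g (b j) (b i) = 0 := hb hj
      simp [this]
    · simp
  have htr : traceL _ (S ∘L S) = ∑ i, g (S (b i)) (S (b i)) / g (b i) (b i) := by
    rw [traceL_apply, LinearMap.trace_eq_matrix_trace ℝ b]
    refine Finset.sum_congr rfl fun i _ => ?_
    rw [eq_div_iff (hpos i).ne']
    simp only [Matrix.diag_apply, LinearMap.toMatrix_apply]
    rw [← hcoef]
    exact hS _ _
  have hnn : ∀ v, 0 ≤ g (S v) (S v) := by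
    intro v
    rcases eq_or_ne (S v) 0 with h0 | h0
    · simp [h0]
    · exact (h.lor_B_pos h0).le
  rw [htr]
  refine ⟨Finset.sum_nonneg fun i _ => div_nonneg (hnn _) (hpos i).le, fun h0 => ?_⟩
  rw [Finset.sum_eq_zero_iff_of_nonneg fun i _ => div_nonneg (hnn _) (hpos i).le] at h0
  have h1 : S.toLinearMap = 0 := by
    refine b.ext fun i => ?_
    by_contra h2
    have h3 : 0 < g (S (b i)) (S (b i)) := h.lor_B_pos h2
    have h4 := h0 i (Finset.mem_univ i)
    have := div_pos h3 (hpos i)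
    linarith
  ext1 v
  exact congrArg (fun f : Coord n →ₗ[ℝ] Coord n => f v) h1

/-- Second-order data of a hypersurface of the hyperboloid: `C`, the derivative of the normal, is
tangential, and the second fundamental form is symmetric. -/
structure IsAdapted₂ (x ν : Mink n) (B C : Coord n →L[ℝ] Mink n) : Prop
    extends IsAdapted x ν B where
  lor_xC : ∀ v, lor x (C v) = 0
  lor_νC : ∀ v, lor ν (C v) = 0
  symm : ∀ v w, lor (C v) (B w) = lor (B v) (C w)

theorem IsAdapted₂.B_shape (h : IsAdapted₂ x ν B C) (v : Coord n) : B (shape x ν B C v) = C v :=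
  (h.C_eq h.lor_xC h.lor_νC v).symm

theorem IsAdapted₂.symm_traceless (h : IsAdapted₂ x ν B C) (H : ℝ) (v w : Coord n) :
    lor (B (traceless H x ν B C v)) (B w) = lor (B v) (B (traceless H x ν B C w)) := by
  simp [traceless, h.B_shape, h.symm]

theorem IsAdapted₂.umbilicity_nonneg (h : IsAdapted₂ x ν B C) (H : ℝ) :
    0 ≤ umbilicity H x ν B C :=
  (traceL_sq_nonneg_and_eq_zero h.toIsAdapted (h.symm_traceless H)).1

theorem IsAdapted₂.traceless_eq_zero (h : IsAdapted₂ x ν B C) {H : ℝ}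
    (h0 : umbilicity H x ν B C = 0) : traceless H x ν B C = 0 :=
  (traceL_sq_nonneg_and_eq_zero h.toIsAdapted (h.symm_traceless H)).2 h0

theorem lor_ν_capVec (θ : ℝ) (ν : Mink n) : lor ν (capVec θ ν) = ν.1 := by
  simp only [capVec, map_add, map_smul, lor_timeVec, smul_eq_mul]
  ring

/-- The derivative of `capVec` along a hypersurface contributes nothing to the trace against the
traceless shape operator. This rests on the symmetry of the second fundamental form only. -/
theorem IsAdapted₂.traceL_capVec (h : IsAdapted₂ x ν B C) (θ H : ℝ) :
    traceL _ (traceless H x ν B C ∘L tangProj x ν B ∘L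
      ((Real.cos θ • (lor.flip (sideVec n) ∘L C)).smulRight (timeVec n) +
        (Real.cos θ • (ContinuousLinearMap.fst ℝ ℝ (Amb n) ∘L C)).smulRight (sideVec n))) = 0 := by
  set S := traceless H x ν B C
  set P := tangProj x ν B
  have h1 : S ∘L P ∘L
      ((Real.cos θ • (lor.flip (sideVec n) ∘L C)).smulRight (timeVec n) +
        (Real.cos θ • (ContinuousLinearMap.fst ℝ ℝ (Amb n) ∘L C)).smulRight (sideVec n)) =
      (Real.cos θ • (lor.flip (sideVec n) ∘L C)).smulRight (S (P (timeVec n))) +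
        (Real.cos θ • (ContinuousLinearMap.fst ℝ ℝ (Amb n) ∘L C)).smulRight
          (S (P (sideVec n))) := by
    ext1 v
    simp
  rw [h1, map_add, traceL_smulRight, traceL_smulRight]
  have h2 : ∀ v z, lor (C v) z = lor (C v) (B (P z)) := by
    intro v z
    rw [← h.B_shape, h.lor_B_tangProj]
  have h3 : ∀ v, (C v).1 = -lor (C v) (timeVec n) := fun v => by rw [lor_timeVec]; ring
  have h4 : ∀ v w, lor (C (S v)) (B w) = lor (C (S w)) (B v) := by
    intro v w
    have h5 : shape x ν B C (S w) = S (shape x ν B C w) := by simp [S, traceless]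
    rw [h.symm, ← h.B_shape w, h.symm_traceless, lor_comm (C (S w)), ← h.B_shape (S w), h5]
  simp only [smul_apply, ContinuousLinearMap.comp_apply,
    ContinuousLinearMap.flip_apply, ContinuousLinearMap.coe_fst', h3, smul_eq_mul]
  rw [h2 _ (sideVec n), h2 _ (timeVec n), h4]
  ring

end Frame


/-! ### Smooth dependence on the frame -/

section Smooth

variable {n : ℕ} {G : Type*} [NormedAddCommGroup G] [NormedSpace ℝ G] {m : WithTop ℕ∞}
  {x ν : G → Mink n} {B C : G → Coord n →L[ℝ] Mink n} {s : Set G} {y : G}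

/-- `frameMap` as a linear function of its three arguments. -/
def frameMapL (n : ℕ) : (Mink n × Mink n × (Coord n →L[ℝ] Mink n)) →L[ℝ]
    ((ℝ × ℝ × Coord n) →L[ℝ] Mink n) :=
  LinearMap.toContinuousLinearMap
    { toFun := fun p => frameMap p.1 p.2.1 p.2.2
      map_add' := by
        intro p q
        apply ContinuousLinearMap.ext
        intro w
        simp only [frameMap_apply, Prod.fst_add, Prod.snd_add, add_apply]
        module
      map_smul' := by
        intro c p
        apply ContinuousLinearMap.ext
        intro w
        simp only [frameMap_apply, Prod.smul_fst, Prod.smul_snd, smul_apply, RingHom.id_apply]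
        module }

theorem contDiffWithinAt_frameMap (hx : ContDiffWithinAt ℝ m x s y)
    (hν : ContDiffWithinAt ℝ m ν s y) (hB : ContDiffWithinAt ℝ m B s y) :
    ContDiffWithinAt ℝ m (fun z => frameMap (x z) (ν z) (B z)) s y :=
  (frameMapL n).contDiff.comp_contDiffWithinAt (hx.prodMk (hν.prodMk hB))

theorem contDiffWithinAt_tangProj (hx : ContDiffWithinAt ℝ m x s y)
    (hν : ContDiffWithinAt ℝ m ν s y) (hB : ContDiffWithinAt ℝ m B s y)
    (h : (frameMap (x y) (ν y) (B y)).IsInvertible) :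
    ContDiffWithinAt ℝ m (fun z => tangProj (x z) (ν z) (B z)) s y := by
  have h1 := contDiffWithinAt_frameMap hx hν hB
  have h2 : ContDiffWithinAt ℝ m (fun z => (frameMap (x z) (ν z) (B z)).inverse) s y :=
    ContDiffAt.comp_contDiffWithinAt (g := ContinuousLinearMap.inverse) y
      h.contDiffAt_map_inverse h1
  exact contDiffWithinAt_const.clm_comp (contDiffWithinAt_const.clm_comp h2)

theorem contDiffWithinAt_shape (hx : ContDiffWithinAt ℝ m x s y)
    (hν : ContDiffWithinAt ℝ m ν s y) (hB : ContDiffWithinAt ℝ m B s y)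
    (hC : ContDiffWithinAt ℝ m C s y) (h : (frameMap (x y) (ν y) (B y)).IsInvertible) :
    ContDiffWithinAt ℝ m (fun z => shape (x z) (ν z) (B z) (C z)) s y :=
  (contDiffWithinAt_tangProj hx hν hB h).clm_comp hC

theorem contDiffWithinAt_traceless (H : ℝ) (hx : ContDiffWithinAt ℝ m x s y)
    (hν : ContDiffWithinAt ℝ m ν s y) (hB : ContDiffWithinAt ℝ m B s y)
    (hC : ContDiffWithinAt ℝ m C s y) (h : (frameMap (x y) (ν y) (B y)).IsInvertible) :
    ContDiffWithinAt ℝ m (fun z => traceless H (x z) (ν z) (B z) (C z)) s y :=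
  (contDiffWithinAt_shape hx hν hB hC h).sub contDiffWithinAt_const

theorem contDiffWithinAt_umbilicity (H : ℝ) (hx : ContDiffWithinAt ℝ m x s y)
    (hν : ContDiffWithinAt ℝ m ν s y) (hB : ContDiffWithinAt ℝ m B s y)
    (hC : ContDiffWithinAt ℝ m C s y) (h : (frameMap (x y) (ν y) (B y)).IsInvertible) :
    ContDiffWithinAt ℝ m (fun z => umbilicity H (x z) (ν z) (B z) (C z)) s y := by
  have h1 := contDiffWithinAt_traceless H hx hν hB hC h
  exact (traceL (Coord n)).contDiff.comp_contDiffWithinAt (h1.clm_comp h1)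

theorem contDiff_capVec (θ : ℝ) : ContDiff ℝ m (capVec (n := n) θ) := by
  unfold capVec
  have : ContDiff ℝ m (fun ν : Mink n => lor ν (sideVec n)) :=
    (lor.flip (sideVec n)).contDiff
  fun_prop

theorem contDiffWithinAt_capField (θ : ℝ) (hx : ContDiffWithinAt ℝ m x s y)
    (hν : ContDiffWithinAt ℝ m ν s y) (hB : ContDiffWithinAt ℝ m B s y)
    (h : (frameMap (x y) (ν y) (B y)).IsInvertible) :
    ContDiffWithinAt ℝ m (fun z => capField θ (x z) (ν z) (B z)) s y :=
  (contDiffWithinAt_tangProj hx hν hB h).clm_apply ((contDiff_capVec θ).comp_contDiffWithinAt hν)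

theorem contDiffWithinAt_flowField (θ H : ℝ) (hx : ContDiffWithinAt ℝ m x s y)
    (hν : ContDiffWithinAt ℝ m ν s y) (hB : ContDiffWithinAt ℝ m B s y)
    (hC : ContDiffWithinAt ℝ m C s y) (h : (frameMap (x y) (ν y) (B y)).IsInvertible) :
    ContDiffWithinAt ℝ m (fun z => flowField θ H (x z) (ν z) (B z) (C z)) s y :=
  (contDiffWithinAt_traceless H hx hν hB hC h).clm_apply (contDiffWithinAt_capField θ hx hν hB h)

theorem continuousWithinAt_density (hx : ContDiffWithinAt ℝ m x s y)
    (hν : ContDiffWithinAt ℝ m ν s y) (hB : ContDiffWithinAt ℝ m B s y) :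
    ContinuousWithinAt (fun z => density (x z) (ν z) (B z)) s y := by
  have h1 := (contDiffWithinAt_frameMap hx hν hB).continuousWithinAt
  have h2 : ContinuousWithinAt (fun z => (minkEquiv n : Mink n →L[ℝ] (ℝ × ℝ × Coord n)) ∘L
      frameMap (x z) (ν z) (B z)) s y := continuousWithinAt_const.clm_comp h1
  exact (ContinuousLinearMap.continuous_det.continuousAt.comp_continuousWithinAt h2).abs

end Smooth

/-! ### The divergence of the flow field -/

section Divergence

variable {n : ℕ} {x ν : Coord n → Mink n} {y : Coord n}

theorem hasFDerivAt_clm_apply {V V' V'' : Type*} [NormedAddCommGroup V] [NormedSpace ℝ V]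
    [NormedAddCommGroup V'] [NormedSpace ℝ V'] [NormedAddCommGroup V''] [NormedSpace ℝ V'']
    (L : V' →L[ℝ] V'') {g : V → V'} {g' : V →L[ℝ] V'} {y : V} (h : HasFDerivAt g g' y) :
    HasFDerivAt (fun z => L (g z)) (L ∘L g') y :=
  L.hasFDerivAt.comp y h

theorem hasFDerivAt_density {B' : Coord n →L[ℝ] Coord n →L[ℝ] Mink n}
    {C : Coord n →L[ℝ] Mink n}
    {B : Coord n → Coord n →L[ℝ] Mink n} (hx : HasFDerivAt x (B y) y) (hν : HasFDerivAt ν C y)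
    (hB : HasFDerivAt B B' y) (h : IsAdapted (x y) (ν y) (B y))
    (h1 : ∀ v, lor (x y) (C v) = 0) (h2 : ∀ v, lor (ν y) (C v) = 0) :
    HasFDerivAt (fun z => density (x z) (ν z) (B z)) (density (x y) (ν y) (B y) •
      (traceL (Coord n) ∘L
        (ContinuousLinearMap.compL ℝ (Coord n) (Mink n) (Coord n)
          (tangProj (x y) (ν y) (B y))) ∘L B')) y := by
  obtain ⟨e, he⟩ := h.isInvertible
  have hΘ : HasFDerivAt (fun z => (minkEquiv n : Mink n →L[ℝ] (ℝ × ℝ × Coord n)) ∘L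
      frameMap (x z) (ν z) (B z))
      ((ContinuousLinearMap.compL ℝ _ _ _ (minkEquiv n : Mink n →L[ℝ] (ℝ × ℝ × Coord n))) ∘L
        (frameMapL n) ∘L ((B y).prod (C.prod B'))) y :=
    hasFDerivAt_clm_apply (ContinuousLinearMap.compL ℝ (ℝ × ℝ × Coord n) _ _
      (minkEquiv n : Mink n →L[ℝ] (ℝ × ℝ × Coord n)))
      (hasFDerivAt_clm_apply (frameMapL n) (hx.prodMk (hν.prodMk hB)))
  have hdet := hasFDerivAt_abs_det (e := e.trans (minkEquiv n)) (by rw [← he]; rfl) hΘ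
  convert! hdet using 1
  rw [density]
  congr 1
  ext1 v
  set R : (ℝ × ℝ × Coord n) →L[ℝ] (ℝ × ℝ × Coord n) :=
    (frameMap (x y) (ν y) (B y)).inverse ∘L frameMap (B y v) (C v) (B' v) with hR
  have hRe : ((e.trans (minkEquiv n)).symm : (ℝ × ℝ × Coord n) →L[ℝ] (ℝ × ℝ × Coord n)) ∘L
      ((minkEquiv n : Mink n →L[ℝ] (ℝ × ℝ × Coord n)) ∘L frameMap (B y v) (C v) (B' v)) = R := by
    apply ContinuousLinearMap.ext
    intro w
    simp [hR, ← he]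
  have hinvB : ∀ w, (frameMap (x y) (ν y) (B y)).inverse (B y w) = (0, 0, w) := by
    intro w
    have h3 : B y w = frameMap (x y) (ν y) (B y) (0, 0, w) := by simp [frameMap_apply]
    rw [h3, h.isInvertible.inverse_apply_self]
  -- only the tangential block of the trace survives, as `dx` and `dν` are tangential
  have hRt : traceL _ R = traceL _ (tangProj (x y) (ν y) (B y) ∘L B' v) := by
    rw [traceL_prod, traceL_prod, traceL_real, traceL_real]
    have h4 : (R (1, 0)).1 = 0 := by simp [hR, frameMap_apply, hinvB]
    have h5 : (R (0, 1, 0)).2.1 = 0 := by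
      simp [hR, frameMap_apply, h.C_eq h1 h2 v, hinvB]
    have h6 : ContinuousLinearMap.snd ℝ ℝ (Coord n) ∘L
        (ContinuousLinearMap.snd ℝ ℝ (ℝ × Coord n) ∘L R ∘L
          ContinuousLinearMap.inr ℝ ℝ (ℝ × Coord n)) ∘L ContinuousLinearMap.inr ℝ ℝ (Coord n) =
        tangProj (x y) (ν y) (B y) ∘L B' v := by
      apply ContinuousLinearMap.ext
      intro w
      simp [hR, frameMap_apply, tangProj]
    rw [h6]
    simp [h4, h5]
  change traceL _ (tangProj (x y) (ν y) (B y) ∘L B' v) = traceL _ _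
  rw [← hRt, ← hRe]
  rfl

theorem traceL_fderiv_smul_flow {W : Coord n → Coord n} {W' : Coord n →L[ℝ] Coord n}
    {r : Coord n → ℝ} {r' : Coord n →L[ℝ] ℝ}
    (hr : HasFDerivAt r r' y) (hW : HasFDerivAt W W' y) :
    traceL _ (fderiv ℝ (fun z => r z • W z) y) = r y * traceL _ W' + r' (W y) := by
  rw [(hr.fun_smul hW).fderiv, map_add, traceL_smulRight, map_smul, smul_eq_mul]

/-- The derivative of the vector `dX(T)`, where `T` is the tangential part of `capVec`. -/
theorem hasFDerivAt_capField {B C : Coord n → Coord n →L[ℝ] Mink n} {θ : ℝ}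
    (hx : HasFDerivAt x (B y) y) (hν : HasFDerivAt ν (C y) y)
    (hA : ∀ᶠ z in 𝓝 y, IsAdapted (x z) (ν z) (B z)) :
    ∃ l : Coord n →L[ℝ] ℝ, HasFDerivAt (fun z => B z (capField θ (x z) (ν z) (B z)))
      (((Real.cos θ • (lor.flip (sideVec n) ∘L C y)).smulRight (timeVec n) +
        (Real.cos θ • (ContinuousLinearMap.fst ℝ ℝ (Amb n) ∘L C y)).smulRight (sideVec n)) +
      (lor (x y) (capVec θ (ν y)) • B y + l.smulRight (x y))
      - ((ν y).1 • C y + (ContinuousLinearMap.fst ℝ ℝ (Amb n) ∘L C y).smulRight (ν y))) y := by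
  have h1 : HasFDerivAt (fun z => (ν z).1) (ContinuousLinearMap.fst ℝ ℝ (Amb n) ∘L C y) y :=
    hasFDerivAt_clm_apply (ContinuousLinearMap.fst ℝ ℝ (Amb n)) hν
  have h2 : HasFDerivAt (fun z => lor (ν z) (sideVec n)) (lor.flip (sideVec n) ∘L C y) y :=
    hasFDerivAt_clm_apply (lor.flip (sideVec n)) hν
  have h3 : HasFDerivAt (fun z => capVec θ (ν z))
      ((Real.cos θ • (lor.flip (sideVec n) ∘L C y)).smulRight (timeVec n) +
      (Real.cos θ • (ContinuousLinearMap.fst ℝ ℝ (Amb n) ∘L C y)).smulRight (sideVec n)) y := by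
    have := ((((h2.const_mul (Real.cos θ)).const_sub 1).neg).smul_const (timeVec n)).add
      ((h1.const_mul (Real.cos θ)).smul_const (sideVec n))
    convert! this using 1
    simp
  have h4 : DifferentiableAt ℝ (fun z => lor (x z) (capVec θ (ν z))) y :=
    (lor.hasFDerivAt_of_bilinear hx h3).differentiableAt
  refine ⟨fderiv ℝ (fun z => lor (x z) (capVec θ (ν z))) y,
    ((h3.add (h4.hasFDerivAt.smul hx)).sub (h1.smul hν)).congr_of_eventuallyEq ?_⟩
  filter_upwards [hA] with z hz
  rw [capField, hz.B_tangProj, lor_ν_capVec]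
  rfl

theorem IsAdapted₂.traceL_capField {x ν : Mink n} {B C : Coord n →L[ℝ] Mink n} {θ H : ℝ}
    (h : IsAdapted₂ x ν B C) (htr : traceL _ (shape x ν B C) = n * H) (l l' : Coord n →L[ℝ] ℝ)
    (q : ℝ) :
    traceL _ (traceless H x ν B C ∘L tangProj x ν B ∘L
      (((Real.cos θ • (lor.flip (sideVec n) ∘L C)).smulRight (timeVec n) +
        (Real.cos θ • (ContinuousLinearMap.fst ℝ ℝ (Amb n) ∘L C)).smulRight (sideVec n)) +
      (q • B + l.smulRight x) - (ν.1 • C + l'.smulRight ν))) =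
      -(ν.1 * umbilicity H x ν B C) := by
  set P := tangProj x ν B with hP
  set S := traceless H x ν B C with hS
  set A := shape x ν B C with hA
  set Q := (Real.cos θ • (lor.flip (sideVec n) ∘L C)).smulRight (timeVec n) +
        (Real.cos θ • (ContinuousLinearMap.fst ℝ ℝ (Amb n) ∘L C)).smulRight (sideVec n)
  have hSA : S = A - H • ContinuousLinearMap.id ℝ (Coord n) := rfl
  have htrS : traceL _ S = 0 := by
    rw [hSA, map_sub, htr, map_smul, traceL_id]
    simp [mul_comm]
  have h1 : S ∘L P ∘L (Q + (q • B + l.smulRight x) - (ν.1 • C + l'.smulRight ν)) =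
      S ∘L P ∘L Q + (q - ν.1 * H) • S - ν.1 • (S ∘L S) := by
    ext1 v
    have hPx : P x = 0 := tangProj_x h.isInvertible
    have hPν : P ν = 0 := tangProj_ν h.isInvertible
    have hPB : P (B v) = v := tangProj_B h.isInvertible v
    have hPC : P (C v) = A v := rfl
    have hSS : S (S v) = S (A v) - H • S v := by
      have : S v = A v - H • v := rfl
      conv_lhs => rw [this, map_sub, map_smul]
    simp only [ContinuousLinearMap.comp_apply, add_apply, sub_apply, smul_apply,
      ContinuousLinearMap.smulRight_apply, map_add, map_sub, map_smul, hPx, hPν, hPB, hPC, hSS,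
      map_zero, smul_zero]
    module
  rw [h1, map_sub, map_add, h.traceL_capVec, map_smul, htrS, map_smul]
  simp [umbilicity, S]

/-- The traced Codazzi equation for hypersurfaces of constant mean curvature: `div (A T)` is the
trace of `A` composed with the covariant derivative of `T`. Here `C' v = D_v dν` and
`B' v = D_v dX`. -/
theorem traceL_codazzi {B C : Coord n → Coord n →L[ℝ] Mink n}
    {B' C' : Coord n →L[ℝ] Coord n →L[ℝ] Mink n}
    (hB : HasFDerivAt B B' y) (hC : HasFDerivAt C C' y)
    (hB' : ∀ v w, B' v w = B' w v) (hC' : ∀ v w, C' v w = C' w v)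
    (hA : ∀ᶠ z in 𝓝 y, IsAdapted₂ (x z) (ν z) (B z) (C z))
    (hAd : DifferentiableAt ℝ (fun z => shape (x z) (ν z) (B z) (C z)) y) {H : ℝ}
    (htr : ∀ᶠ z in 𝓝 y, traceL _ (shape (x z) (ν z) (B z) (C z)) = H)
    (w : Coord n) (T' : Coord n →L[ℝ] Coord n) :
    traceL _ (tangProj (x y) (ν y) (B y) ∘L (C y ∘L T' + C'.flip w)) =
      traceL _ (shape (x y) (ν y) (B y) (C y) ∘L tangProj (x y) (ν y) (B y) ∘L
        (B y ∘L T' + B'.flip w)) := by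
  set A := fun z => shape (x z) (ν z) (B z) (C z)
  set A' := fderiv ℝ A y
  set P := tangProj (x y) (ν y) (B y)
  have hPB : ∀ v, P (B y v) = v := tangProj_B hA.self_of_nhds.isInvertible
  have htrA : ∀ v, traceL _ (A' v) = 0 := by
    have h1 : HasFDerivAt (fun z => traceL _ (A z)) (traceL _ ∘L A') y :=
      hasFDerivAt_clm_apply (traceL _) hAd.hasFDerivAt
    have h2 : HasFDerivAt (fun z => traceL _ (A z)) (0 : Coord n →L[ℝ] ℝ) y :=
      (hasFDerivAt_const H y).congr_of_eventuallyEq htr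
    intro v
    exact congrArg (fun l : Coord n →L[ℝ] ℝ => l v) (h1.unique h2)
  -- differentiate `dν = dX ∘ A`
  have hCBA : ∀ v, C' v = B' v ∘L A y + B y ∘L A' v := by
    have h1 : HasFDerivAt (fun z => B z ∘L A z) _ y := hB.clm_comp hAd.hasFDerivAt
    have h2 : C' = _ := hC.unique (h1.congr_of_eventuallyEq (by
      filter_upwards [hA] with z hz
      ext1 v
      exact (hz.B_shape v).symm))
    intro v
    rw [h2]
    ext1 w
    simp
    abel
  have h1 : P ∘L C'.flip w = (P ∘L B'.flip w) ∘L A y + A' w := by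
    ext1 v
    have h2 : C' v w = B' (A y v) w + B y (A' w v) := by
      rw [hC', hCBA, hB']
      simp
    simp [h2, hPB]
  have h2 : P ∘L B y ∘L T' = T' := by ext1 v; simp [hPB]
  rw [ContinuousLinearMap.comp_add, ContinuousLinearMap.comp_add, ContinuousLinearMap.comp_add,
    map_add, map_add, h1, map_add, htrA, add_zero, h2]
  exact congrArg₂ (· + ·) rfl (traceL_comp_comm _ _)

/-- If `P` is a left inverse of `B`, the trace of the derivative `W'` of a vector field is found
from the derivative `B W' + B'(·) W` of its image under `B`. -/
theorem traceL_of_frame_derivatives {F E : Type*} [NormedAddCommGroup F] [NormedSpace ℝ F]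
    [FiniteDimensional ℝ F] [NormedAddCommGroup E] [NormedSpace ℝ E]
    {P : E →L[ℝ] F} {B C : F →L[ℝ] E} {B' C' : F →L[ℝ] F →L[ℝ] E} {W T : F}
    {W' T' A : F →L[ℝ] F} {H a : ℝ}
    (hB' : ∀ v w, B' v w = B' w v) (hPB : ∀ v, P (B v) = v)
    (hBW : B ∘L W' + B'.flip W = (C ∘L T' + C'.flip T) - H • (B ∘L T' + B'.flip T))
    (hcod : traceL _ (P ∘L (C ∘L T' + C'.flip T)) =
      traceL _ (A ∘L P ∘L (B ∘L T' + B'.flip T)))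
    (ha : traceL _ ((A - H • ContinuousLinearMap.id ℝ F) ∘L P ∘L (B ∘L T' + B'.flip T)) = a) :
    traceL _ W' = a - traceL _ (P ∘L B' W) := by
  have h1 : traceL _ (P ∘L (B ∘L W' + B'.flip W)) = traceL _ W' + traceL _ (P ∘L B' W) := by
    rw [← map_add]
    congr 1
    ext1 v
    simp [hPB, hB' v]
  have h2 : traceL _ (P ∘L (B ∘L W' + B'.flip W)) = a := by
    rw [hBW, ← ha, ContinuousLinearMap.comp_sub, map_sub, hcod, ContinuousLinearMap.sub_comp,
      map_sub]
    congr 2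
    ext1 v
    simp
  linarith

/-- The divergence of `ρ f W`, where `ρ` is the volume density and `W` the flow field, at an
interior point of a hypersurface of constant mean curvature. Here `B` and `C` are the derivatives of
`x` and `ν`. -/
theorem divergence_flowField {B C : Coord n → Coord n →L[ℝ] Mink n} {θ H : ℝ}
    {B' C' : Coord n →L[ℝ] Coord n →L[ℝ] Mink n}
    (hx : ContDiffAt ℝ 1 x y) (hν : ContDiffAt ℝ 1 ν y)
    (hBs : ContDiffAt ℝ 1 B y) (hCs : ContDiffAt ℝ 1 C y)
    (hxd : HasFDerivAt x (B y) y) (hνd : HasFDerivAt ν (C y) y)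
    (hBd : HasFDerivAt B B' y) (hCd : HasFDerivAt C C' y)
    (hB' : ∀ v w, B' v w = B' w v) (hC' : ∀ v w, C' v w = C' w v)
    (hA : ∀ᶠ z in 𝓝 y, IsAdapted₂ (x z) (ν z) (B z) (C z))
    (htr : ∀ᶠ z in 𝓝 y, traceL _ (shape (x z) (ν z) (B z) (C z)) = n * H)
    {f : Coord n → ℝ} (hf : DifferentiableAt ℝ f y) :
    DifferentiableAt ℝ (fun z => (density (x z) (ν z) (B z) * f z) •
        flowField θ H (x z) (ν z) (B z) (C z)) y ∧
    traceL _ (fderiv ℝ (fun z => (density (x z) (ν z) (B z) * f z) •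
        flowField θ H (x z) (ν z) (B z) (C z)) y) =
      density (x y) (ν y) (B y) *
        (fderiv ℝ f y (flowField θ H (x y) (ν y) (B y) (C y)) -
          f y * ((ν y).1 * umbilicity H (x y) (ν y) (B y) (C y))) := by
  have hAy := hA.self_of_nhds
  have hinv := hAy.isInvertible
  have hTd : DifferentiableAt ℝ (fun z => capField θ (x z) (ν z) (B z)) y :=
    (contDiffWithinAt_univ.1 (contDiffWithinAt_capField (s := univ) θ hx hν hBs hinv)
      ).differentiableAt one_ne_zero
  have hWd : DifferentiableAt ℝ (fun z => flowField θ H (x z) (ν z) (B z) (C z)) y :=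
    (contDiffWithinAt_univ.1 (contDiffWithinAt_flowField (s := univ) θ H hx hν hBs hCs hinv)
      ).differentiableAt one_ne_zero
  have hAd : DifferentiableAt ℝ (fun z => shape (x z) (ν z) (B z) (C z)) y :=
    (contDiffWithinAt_univ.1 (contDiffWithinAt_shape (s := univ) hx hν hBs hCs hinv)
      ).differentiableAt one_ne_zero
  have hρd := hasFDerivAt_density hxd hνd hBd hAy.toIsAdapted hAy.lor_xC hAy.lor_νC
  have hrd := hρd.fun_mul hf.hasFDerivAt
  refine ⟨hrd.differentiableAt.fun_smul hWd, ?_⟩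
  rw [traceL_fderiv_smul_flow hrd hWd.hasFDerivAt]
  have hPB : ∀ v, tangProj (x y) (ν y) (B y) (B y v) = v := tangProj_B hinv
  have hBT : HasFDerivAt (fun z => B z (capField θ (x z) (ν z) (B z))) _ y :=
    hBd.clm_apply hTd.hasFDerivAt
  have hBW : HasFDerivAt (fun z => B z (flowField θ H (x z) (ν z) (B z) (C z))) _ y :=
    hBd.clm_apply hWd.hasFDerivAt
  have hCT : HasFDerivAt (fun z => C z (capField θ (x z) (ν z) (B z))) _ y :=
    hCd.clm_apply hTd.hasFDerivAt
  -- `dX(W) = dν(T) - H dX(T)` near `y`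
  have hBW2 := hBW.unique ((hCT.sub (hBT.const_smul H)).congr_of_eventuallyEq (by
    filter_upwards [hA] with z hz
    simp only [flowField, traceless]
    simp [hz.B_shape]))
  have hkey := traceL_codazzi hBd hCd hB' hC' hA hAd htr (capField θ (x y) (ν y) (B y))
    (fderiv ℝ (fun z => capField θ (x z) (ν z) (B z)) y)
  obtain ⟨l, hl⟩ := hasFDerivAt_capField (θ := θ) hxd hνd (hA.mono fun z hz => hz.toIsAdapted)
  have hfin := hAy.traceL_capField (θ := θ) htr.self_of_nhds l
    (ContinuousLinearMap.fst ℝ ℝ (Amb n) ∘L C y) (lor (x y) (capVec θ (ν y)))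
  rw [← hBT.unique hl] at hfin
  have hW' := traceL_of_frame_derivatives (fun v w => hB' v w) hPB hBW2 hkey hfin
  rw [hW']
  simp only [add_apply, smul_apply, ContinuousLinearMap.comp_apply, smul_eq_mul,
    ContinuousLinearMap.compL_apply]
  ring

end Divergence


/-! ### The divergence theorem on a half-space -/

section HalfSpace

theorem integral_divergence_halfSpace_pi {m : ℕ} {f : (Fin (m + 1) → ℝ) → Fin (m + 1) → ℝ}
    {f' : (Fin (m + 1) → ℝ) → (Fin (m + 1) → ℝ) →L[ℝ] (Fin (m + 1) → ℝ)}
    {g : (Fin (m + 1) → ℝ) → ℝ} {R : ℝ} (hR : 0 < R)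
    (hf : ContinuousOn f {y | 0 ≤ y 0}) (hg : ContinuousOn g {y | 0 ≤ y 0})
    (hfR : ∀ y i, R ≤ |y i| → f y = 0) (hgR : ∀ y i, R ≤ |y i| → g y = 0)
    (hf0 : ∀ y, y 0 = 0 → f y 0 = 0) (hd : ∀ y, 0 < y 0 → HasFDerivAt f (f' y) y)
    (htr : ∀ y, 0 < y 0 → ∑ i, f' y (Pi.single i 1) i = g y) :
    ∫ y in {y : Fin (m + 1) → ℝ | 0 ≤ y 0}, g y = 0 := by
  -- integrate over the box `[0, R] × [-R, R]ᵐ`, whose bottom face lies on the boundary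
  set a : Fin (m + 1) → ℝ := Function.update (fun _ => -R) 0 0 with ha
  set b : Fin (m + 1) → ℝ := fun _ => R with hb
  have hle : a ≤ b := by
    intro i
    rcases eq_or_ne i 0 with rfl | hi
    · simp [ha, hb, hR.le]
    · simp [ha, hb, hi]; linarith
  have hsub : Icc a b ⊆ {y | 0 ≤ y 0} := by
    intro y hy
    have := hy.1 0
    simpa [ha] using this
  have hae : (fun x => ∑ i, f' x (Pi.single i 1) i) =ᵐ[volume.restrict (Icc a b)] g := by
    have h1 : (Set.pi univ fun i => Ioo (a i) (b i)) =ᵐ[volume] Icc a b :=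
      Measure.univ_pi_Ioo_ae_eq_Icc
    rw [← Measure.restrict_congr_set h1]
    filter_upwards [ae_restrict_mem (MeasurableSet.univ_pi fun i => measurableSet_Ioo)] with y hy
    refine htr y ?_
    have := (hy 0 (mem_univ _)).1
    simpa [ha] using this
  have hint : IntegrableOn g (Icc a b) := (hg.mono hsub).integrableOn_Icc
  have hdiv := integral_divergence_of_hasFDerivAt_off_countable a b hle f f' ∅ countable_empty
    (hf.mono hsub) (by
      rintro y ⟨hy, -⟩
      refine hd y ?_
      have := (hy 0 (mem_univ _)).1
      simpa [ha] using this) (hint.congr hae.symm)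
  rw [integral_congr_ae hae] at hdiv
  have hrhs : ∀ i : Fin (m + 1), ((∫ x in Icc (a ∘ i.succAbove) (b ∘ i.succAbove),
      f (i.insertNth (b i) x) i) -
        ∫ x in Icc (a ∘ i.succAbove) (b ∘ i.succAbove), f (i.insertNth (a i) x) i) = 0 := by
    intro i
    have h1 : ∀ x : Fin m → ℝ, f (i.insertNth (b i) x) i = 0 := by
      intro x
      rw [hfR (i.insertNth (b i) x) i (by simp [hb, le_abs_self])]
      rfl
    have h2 : ∀ x : Fin m → ℝ, f (i.insertNth (a i) x) i = 0 := by
      intro x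
      rcases eq_or_ne i 0 with rfl | hi
      · exact hf0 _ (by simp [ha])
      · rw [hfR (i.insertNth (a i) x) i (by simp [ha, hi, le_abs_self])]
        rfl
    simp [h1, h2]
  rw [Finset.sum_eq_zero fun i _ => hrhs i] at hdiv
  refine Eq.trans ?_ hdiv
  refine setIntegral_eq_of_subset_of_forall_sdiff_eq_zero
    (measurableSet_le measurable_const (measurable_pi_apply 0)) hsub ?_
  rintro y ⟨hy, hy2⟩
  by_contra h0
  apply hy2
  have h1 : ∀ i, |y i| < R := fun i => by
    by_contra h2
    exact h0 (hgR y i (not_lt.1 h2))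
  refine ⟨fun i => ?_, fun i => (abs_lt.1 (h1 i)).2.le⟩
  rcases eq_or_ne i 0 with rfl | hi
  · simpa [ha] using hy
  · simpa [ha, hi] using (abs_lt.1 (h1 i)).1.le

/-- The divergence theorem for a compactly supported vector field `V` on a half-space that is
tangent to the boundary. Differentiability is needed in the interior only. -/
theorem integral_divergence_halfSpace {n : ℕ} [NeZero n]
    {V : EuclideanSpace ℝ (Fin n) → EuclideanSpace ℝ (Fin n)} {g : EuclideanSpace ℝ (Fin n) → ℝ}
    {K : Set (EuclideanSpace ℝ (Fin n))} (hK : IsCompact K)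
    (hV : ContinuousOn V {y | 0 ≤ y 0}) (hg : ContinuousOn g {y | 0 ≤ y 0})
    (hVK : ∀ y ∉ K, V y = 0) (hgK : ∀ y ∉ K, g y = 0)
    (hV0 : ∀ y, y 0 = 0 → V y 0 = 0) (hd : ∀ y, 0 < y 0 → DifferentiableAt ℝ V y)
    (htr : ∀ y, 0 < y 0 → traceL _ (fderiv ℝ V y) = g y) :
    ∫ y in {y : EuclideanSpace ℝ (Fin n) | 0 ≤ y 0}, g y = 0 := by
  obtain ⟨m, rfl⟩ : ∃ m, n = m + 1 := Nat.exists_eq_succ_of_ne_zero (NeZero.ne n)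
  obtain ⟨R, hR, hKR⟩ : ∃ R : ℝ, 0 < R ∧ ∀ y ∈ K, ‖y‖ < R := by
    obtain ⟨R, hR⟩ := hK.isBounded.exists_norm_le
    exact ⟨|R| + 1, by positivity, fun y hy => by linarith [hR y hy, le_abs_self R]⟩
  let e := EuclideanSpace.equiv (Fin (m + 1)) ℝ
  have hout : ∀ (y : Fin (m + 1) → ℝ) i, R ≤ |y i| → e.symm y ∉ K := by
    intro y i hi hy
    have h1 := hKR _ hy
    have h2 := PiLp.norm_apply_le (e.symm y) i
    have h3 : (e.symm y) i = y i := rfl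
    rw [h3, Real.norm_eq_abs] at h2
    linarith
  have hmaps : MapsTo e.symm {y : Fin (m + 1) → ℝ | 0 ≤ y 0} {y | 0 ≤ y 0} := fun y hy => hy
  have h := integral_divergence_halfSpace_pi (f := fun y => e (V (e.symm y)))
    (f' := fun y => (e : _ →L[ℝ] (Fin (m + 1) → ℝ)) ∘L (fderiv ℝ V (e.symm y)) ∘L
      (e.symm : (Fin (m + 1) → ℝ) →L[ℝ] _)) (g := fun y => g (e.symm y)) hR
    (e.continuous.comp_continuousOn (hV.comp e.symm.continuous.continuousOn hmaps))
    (hg.comp e.symm.continuous.continuousOn hmaps)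
    (fun y i hi => by rw [hVK _ (hout y i hi), map_zero])
    (fun y i hi => hgK _ (hout y i hi))
    (fun y hy => hV0 (e.symm y) hy)
    (fun y hy => by
      have h1 : HasFDerivAt V (fderiv ℝ V (e.symm y)) (e.symm y) :=
        (hd (e.symm y) hy).hasFDerivAt
      exact e.hasFDerivAt.comp y (h1.comp y e.symm.hasFDerivAt))
    (fun y hy => by
      rw [← htr (e.symm y) hy, traceL_euclidean]
      rfl)
  refine Eq.trans ?_ h
  exact ((PiLp.volume_preserving_toLp (Fin (m + 1))).setIntegral_preimage_emb
      (MeasurableEquiv.toLp 2 (Fin (m + 1) → ℝ)).measurableEmbedding g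
      {y : EuclideanSpace ℝ (Fin (m + 1)) | 0 ≤ y 0}).symm

end HalfSpace


/-! ### From the Poincaré ball to the hyperboloid -/

section Lift

variable {n : ℕ}

/-- The isometry from the Poincaré ball to the hyperboloid in Minkowski space. -/
def hypLift (x : Amb n) : Mink n :=
  ((1 + ‖x‖ ^ 2) * (1 - ‖x‖ ^ 2)⁻¹, (2 * (1 - ‖x‖ ^ 2)⁻¹) • x)

/-- The differential of `hypLift` at `x`, applied to `v`. -/
def vecLift (x v : Amb n) : Mink n :=
  (4 * ⟪x, v⟫_ℝ * ((1 - ‖x‖ ^ 2)⁻¹) ^ 2,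
    (2 * (1 - ‖x‖ ^ 2)⁻¹) • v + (4 * ⟪x, v⟫_ℝ * ((1 - ‖x‖ ^ 2)⁻¹) ^ 2) • x)

theorem one_sub_norm_sq_ne {x : Amb n} (hx : ‖x‖ < 1) : 1 - ‖x‖ ^ 2 ≠ 0 := by
  nlinarith [norm_nonneg x]

theorem lor_hypLift_self {x : Amb n} (hx : ‖x‖ < 1) : lor (hypLift x) (hypLift x) = -1 := by
  have h0 := one_sub_norm_sq_ne hx
  simp only [lor_apply, hypLift, inner_smul_left, inner_smul_right, real_inner_self_eq_norm_sq,
    RCLike.conj_to_real]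
  field_simp
  ring

theorem lor_hypLift_vecLift {x : Amb n} (hx : ‖x‖ < 1) (v : Amb n) :
    lor (hypLift x) (vecLift x v) = 0 := by
  have h0 := one_sub_norm_sq_ne hx
  simp only [lor_apply, hypLift, vecLift, inner_smul_left, inner_smul_right, inner_add_right,
    real_inner_self_eq_norm_sq, RCLike.conj_to_real]
  field_simp
  ring

theorem lor_vecLift {x : Amb n} (hx : ‖x‖ < 1) (v w : Amb n) :
    lor (vecLift x v) (vecLift x w) = hypMetric x v w := by
  have h0 := one_sub_norm_sq_ne hx
  simp only [lor_apply, hypMetric, vecLift, inner_smul_left, inner_smul_right, inner_add_right,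
    inner_add_left, real_inner_self_eq_norm_sq, RCLike.conj_to_real, real_inner_comm x v]
  field_simp
  ring

theorem hasFDerivAt_inv_one_sub_norm_sq {x : Amb n} (hx : ‖x‖ < 1) :
    HasFDerivAt (fun y : Amb n => (1 - ‖y‖ ^ 2)⁻¹)
      ((2 * ((1 - ‖x‖ ^ 2)⁻¹) ^ 2) • innerSL ℝ x) x := by
  have h0 := one_sub_norm_sq_ne hx
  have h1 : HasFDerivAt (fun y : Amb n => ‖y‖ ^ 2) (2 • innerSL ℝ x) x :=
    (hasStrictFDerivAt_norm_sq x).hasFDerivAt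
  have h2 := (hasDerivAt_inv h0).comp_hasFDerivAt x (h1.const_sub 1)
  convert! h2 using 1
  ext v
  simp
  ring

theorem hasFDerivAt_hypLift {x : Amb n} (hx : ‖x‖ < 1) :
    ∃ L : Amb n →L[ℝ] Mink n, HasFDerivAt hypLift L x ∧ ∀ v, L v = vecLift x v := by
  have h0 := one_sub_norm_sq_ne hx
  have h1 : HasFDerivAt (fun y : Amb n => ‖y‖ ^ 2) (2 • innerSL ℝ x) x :=
    (hasStrictFDerivAt_norm_sq x).hasFDerivAt
  have h2 := hasFDerivAt_inv_one_sub_norm_sq hx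
  refine ⟨_, (((h1.const_add 1).fun_mul h2).prodMk
    ((h2.const_mul 2).fun_smul (hasFDerivAt_id x))), fun v => ?_⟩
  refine Prod.ext ?_ ?_
  · simp [vecLift]
    field_simp
    ring
  · simp [vecLift]
    module

/-- Covariant differentiation becomes flat differentiation, up to a multiple of the position. -/
theorem hasFDerivAt_vecLift {x v : Amb n} (hx : ‖x‖ < 1) :
    ∃ L : (Amb n × Amb n) →L[ℝ] Mink n, HasFDerivAt (fun p => vecLift p.1 p.2) L (x, v) ∧
      ∀ a b, L (a, b) = vecLift x (b + christoffel x a v) + hypMetric x a v • hypLift x := by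
  have h0 := one_sub_norm_sq_ne hx
  have hf : HasFDerivAt (fun p : Amb n × Amb n => p.1) (ContinuousLinearMap.fst ℝ _ _) (x, v) :=
    hasFDerivAt_fst
  have hs : HasFDerivAt (fun p : Amb n × Amb n => p.2) (ContinuousLinearMap.snd ℝ _ _) (x, v) :=
    hasFDerivAt_snd
  have h2 : HasFDerivAt (fun p : Amb n × Amb n => (1 - ‖p.1‖ ^ 2)⁻¹) _ (x, v) :=
    (hasFDerivAt_inv_one_sub_norm_sq (x := (x, v).1) hx).comp (x, v) hf
  have h3 : HasFDerivAt (fun p : Amb n × Amb n => ⟪p.1, p.2⟫_ℝ) _ (x, v) := hf.inner ℝ hs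
  have h5 : HasFDerivAt (fun p : Amb n × Amb n => ((1 - ‖p.1‖ ^ 2)⁻¹) ^ 2) _ (x, v) := h2.pow 2
  have h4 := (h3.const_mul 4).fun_mul h5
  refine ⟨_, h4.prodMk (((h2.const_mul 2).fun_smul hs).fun_add (h4.fun_smul hf)), fun a b => ?_⟩
  refine Prod.ext ?_ ?_
  · simp [vecLift, christoffel, hypLift, hypMetric, inner_add_right, inner_sub_right,
      inner_smul_right]
    field_simp
    ring
  · simp [vecLift, christoffel, hypLift, hypMetric, inner_add_right, inner_sub_right,
      inner_smul_right]
    ext i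
    simp
    field_simp
    ring

theorem contDiffAt_inv_one_sub_norm_sq {x : Amb n} (hx : ‖x‖ < 1) :
    ContDiffAt ℝ ∞ (fun y : Amb n => (1 - ‖y‖ ^ 2)⁻¹) x :=
  ((contDiff_const.sub (contDiff_norm_sq ℝ)).contDiffAt).inv (one_sub_norm_sq_ne hx)

theorem contDiffAt_hypLift {x : Amb n} (hx : ‖x‖ < 1) : ContDiffAt ℝ ∞ (hypLift (n := n)) x :=
  (((contDiff_const.add (contDiff_norm_sq ℝ)).contDiffAt).mul
    (contDiffAt_inv_one_sub_norm_sq hx)).prodMk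
    ((contDiffAt_const.mul (contDiffAt_inv_one_sub_norm_sq hx)).smul contDiffAt_id)

theorem contDiffAt_vecLift {x v : Amb n} (hx : ‖x‖ < 1) :
    ContDiffAt ℝ ∞ (fun p : Amb n × Amb n => vecLift p.1 p.2) (x, v) := by
  have h1 : ContDiffAt ℝ ∞ (fun p : Amb n × Amb n => (1 - ‖p.1‖ ^ 2)⁻¹) (x, v) :=
    (contDiffAt_inv_one_sub_norm_sq (x := (x, v).1) hx).comp (x, v) contDiffAt_fst
  have h2 : ContDiffAt ℝ ∞ (fun p : Amb n × Amb n => 4 * ⟪p.1, p.2⟫_ℝ *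
      ((1 - ‖p.1‖ ^ 2)⁻¹) ^ 2) (x, v) :=
    (contDiffAt_const.mul (contDiffAt_fst.inner ℝ contDiffAt_snd)).mul (h1.pow 2)
  exact h2.prodMk (((contDiffAt_const.mul h1).smul contDiffAt_snd).add (h2.smul contDiffAt_fst))

end Lift

section Hypersurface

variable {n : ℕ} [NeZero n] {M : Type*} [TopologicalSpace M] [ChartedSpace (EuclideanHalfSpace n) M]

/-- The differential of a map from a manifold with boundary to Minkowski space. -/
def mdiff (Y : M → Mink n) (p : M) : Coord n →L[ℝ] Mink n :=
  mfderiv (𝓡∂ n) 𝓘(ℝ, Mink n) Y p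

/-- An immersed hypersurface `x` of the hyperboloid, with unit normal `ν`. -/
structure IsHypersurface (x ν : M → Mink n) : Prop where
  smooth_x : ContMDiff (𝓡∂ n) 𝓘(ℝ, Mink n) ∞ x
  smooth_ν : ContMDiff (𝓡∂ n) 𝓘(ℝ, Mink n) ∞ ν
  adapted : ∀ p, IsAdapted (x p) (ν p) (mdiff x p)

variable {X ν : M → Amb n}

theorem mdiff_hypLift (hX : IsImmersedInHalfBall X) (p : M) (v : Coord n) :
    mdiff (fun q => hypLift (X q)) p v = vecLift (X p) (diff X p v) := by
  obtain ⟨L, hL, hLv⟩ := hasFDerivAt_hypLift (hX.mem_halfBall p).1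
  have h1 : HasMFDerivAt (𝓡∂ n) 𝓘(ℝ, Amb n) X p (mfderiv (𝓡∂ n) 𝓘(ℝ, Amb n) X p) :=
    (hX.smooth.mdifferentiable (by simp) p).hasMFDerivAt
  have h2 := hL.hasMFDerivAt.comp p h1
  have h3 : mdiff (fun q => hypLift (X q)) p = L ∘L (diff X p) := h2.mfderiv
  rw [h3]
  exact hLv _

theorem mdiff_vecLift (hX : IsImmersedInHalfBall X) (hν : IsUnitNormal X ν) (p : M)
    (v : Coord n) :
    mdiff (fun q => vecLift (X q) (ν q)) p v = vecLift (X p) (covDeriv X ν p v) := by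
  obtain ⟨L, hL, hLv⟩ := hasFDerivAt_vecLift (v := ν p) (hX.mem_halfBall p).1
  have h1 : HasMFDerivAt (𝓡∂ n) 𝓘(ℝ, Amb n) X p (mfderiv (𝓡∂ n) 𝓘(ℝ, Amb n) X p) :=
    (hX.smooth.mdifferentiable (by simp) p).hasMFDerivAt
  have h1' : HasMFDerivAt (𝓡∂ n) 𝓘(ℝ, Amb n) ν p (mfderiv (𝓡∂ n) 𝓘(ℝ, Amb n) ν p) :=
    (hν.smooth.mdifferentiable (by simp) p).hasMFDerivAt
  have h12 : HasMFDerivAt (𝓡∂ n) 𝓘(ℝ, Amb n × Amb n) (fun q => (X q, ν q)) p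
      ((diff X p).prod (diff ν p)) :=
    ⟨h1.1.prodMk h1'.1, HasFDerivWithinAt.prodMk h1.2 h1'.2⟩
  have h2 := HasMFDerivAt.comp (f := fun q => (X q, ν q)) p hL.hasMFDerivAt h12
  have h3 : mdiff (fun q => vecLift (X q) (ν q)) p = L ∘L ((diff X p).prod (diff ν p)) :=
    h2.mfderiv
  rw [h3]
  have h4 : (hypMetric (X p) (diff X p v) (ν p)) = 0 := by
    have := hν.orthogonal p v
    unfold hypMetric at this ⊢
    rwa [real_inner_comm]
  have h5 := hLv (diff X p v) (diff ν p v)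
  rw [h4, zero_smul, add_zero] at h5
  exact h5

theorem isHypersurface_lift (hX : IsImmersedInHalfBall X) (hν : IsUnitNormal X ν) :
    IsHypersurface (fun q => hypLift (X q)) (fun q => vecLift (X q) (ν q)) where
  smooth_x p := by
    exact (contDiffAt_hypLift (hX.mem_halfBall p).1).contMDiffAt.comp p (hX.smooth p)
  smooth_ν p := by
    exact (contDiffAt_vecLift (x := X p) (v := ν p) (hX.mem_halfBall p).1).contMDiffAt.comp p
      ((hX.smooth p).prodMk_space (hν.smooth p))
  adapted p := by
    have hx := (hX.mem_halfBall p).1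
    refine ⟨lor_hypLift_self hx, ?_, lor_hypLift_vecLift hx _, fun v => ?_, fun v => ?_, ?_⟩
    · rw [lor_vecLift hx, hν.unit p]
    · rw [mdiff_hypLift hX, lor_hypLift_vecLift hx]
    · rw [mdiff_hypLift hX, lor_vecLift hx]
      exact hν.orthogonal p v
    · rw [injective_iff_map_eq_zero]
      intro v hv
      have h1 : hypMetric (X p) (diff X p v) (diff X p v) = 0 := by
        rw [← lor_vecLift hx, ← mdiff_hypLift hX, hv]
        simp
      have h2 : diff X p v = 0 := by
        unfold hypMetric at h1
        have h0 := one_sub_norm_sq_ne hx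
        simpa [h0] using h1
      exact hX.injective_diff p (h2.trans (map_zero _).symm)

end Hypersurface


/-! ### Hypersurfaces in charts -/

section Chart

variable {n : ℕ}

theorem hasFDerivWithinAt_lor {a b : Coord n → Mink n} {a' b' : Coord n →L[ℝ] Mink n}
    {s : Set (Coord n)} {y : Coord n} (ha : HasFDerivWithinAt a a' s y)
    (hb : HasFDerivWithinAt b b' s y) :
    HasFDerivWithinAt (fun z => lor (a z) (b z))
      (lor (a y) ∘L b' + lor.flip (b y) ∘L a') s y := by
  convert! lor.hasFDerivWithinAt_of_bilinear ha hb using 1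

variable [NeZero n]

/-- The closed half-space on which the charts of a manifold with boundary are modelled. -/
abbrev halfSpace (n : ℕ) [NeZero n] : Set (Coord n) := range (𝓡∂ n)

theorem halfSpace_eq : halfSpace n = {y | 0 ≤ y 0} := range_modelWithCornersEuclideanHalfSpace n

theorem interior_halfSpace_eq : interior (halfSpace n) = {y | 0 < y 0} :=
  interior_range_modelWithCornersEuclideanHalfSpace n

theorem uniqueDiffOn_halfSpace : UniqueDiffOn ℝ (halfSpace n) := (𝓡∂ n).uniqueDiffOn

theorem halfSpace_subset_closure : halfSpace n ⊆ closure (interior (halfSpace n)) :=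
  (𝓡∂ n).range_subset_closure_interior

variable {M : Type*} [TopologicalSpace M] [ChartedSpace (EuclideanHalfSpace n) M]
  {V : Type*} [NormedAddCommGroup V] [NormedSpace ℝ V]

/-- The target in the half-space of the chart around `p`. -/
abbrev chartTarget (p : M) : Set (Coord n) := (extChartAt (𝓡∂ n) p).target

/-- The map `Y` in the chart around `p`. -/
def chartRep (Y : M → V) (p : M) (y : Coord n) : V := Y ((extChartAt (𝓡∂ n) p).symm y)

/-- The differential of the map `Y` in the chart around `p`. -/
def chartDiff (Y : M → V) (p : M) (y : Coord n) : Coord n →L[ℝ] V :=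
  fderivWithin ℝ (chartRep Y p) (halfSpace n) y

theorem chartTarget_subset (p : M) : chartTarget (n := n) p ⊆ halfSpace n :=
  extChartAt_target_subset_range p

theorem chartTarget_mem_nhdsWithin {p : M} {y : Coord n} (hy : y ∈ chartTarget p) :
    chartTarget p ∈ 𝓝[halfSpace n] y := extChartAt_target_mem_nhdsWithin_of_mem hy

theorem exists_isOpen_chartTarget (p : M) :
    ∃ U : Set (Coord n), IsOpen U ∧ chartTarget (n := n) p = U ∩ halfSpace n :=
  ⟨_, (chartAt _ p).open_target.preimage (𝓡∂ n).continuous_symm, extChartAt_target (I := 𝓡∂ n) p⟩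

theorem measurableSet_chartTarget (p : M) : MeasurableSet (chartTarget (n := n) p) := by
  obtain ⟨U, hU, h⟩ := exists_isOpen_chartTarget (n := n) p
  rw [h]
  exact hU.measurableSet.inter (𝓡∂ n).isClosed_range.measurableSet

theorem chartTarget_subset_closure (p : M) :
    chartTarget (n := n) p ⊆ closure (interior (chartTarget (n := n) p)) := by
  obtain ⟨U, hU, h⟩ := exists_isOpen_chartTarget (n := n) p
  rw [h, interior_inter, hU.interior_eq]
  intro y hy
  exact hU.inter_closure ⟨hy.1, halfSpace_subset_closure hy.2⟩

/-- A function that is constant along the boundary has vanishing tangential derivative there. -/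
theorem fderivWithin_eq_zero_of_boundary_const {F : Coord n → ℝ} {F' : Coord n →L[ℝ] ℝ} {p : M}
    {y : Coord n} (hy : y ∈ chartTarget p) (h0 : y 0 = 0) {c : ℝ}
    (h : HasFDerivWithinAt F F' (halfSpace n) y)
    (hF : ∀ z ∈ chartTarget p, z 0 = 0 → F z = c) {v : Coord n} (hv : v 0 = 0) : F' v = 0 := by
  have hmem : ∀ t : ℝ, y + t • v ∈ halfSpace n := by
    intro t
    rw [halfSpace_eq]
    simp [h0, hv]
  have hline : HasDerivAt (fun t : ℝ => y + t • v) v 0 := by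
    simpa using ((hasDerivAt_id (0 : ℝ)).smul_const v).const_add y
  have h' : HasFDerivWithinAt F F' (halfSpace n) (y + (0 : ℝ) • v) := by simpa using h
  have h1 : HasDerivAt (fun t : ℝ => F (y + t • v)) (F' v) 0 :=
    h'.comp_hasDerivAt (0 : ℝ) hline (Eventually.of_forall hmem)
  have htend : Tendsto (fun t : ℝ => y + t • v) (𝓝 0) (𝓝[halfSpace n] y) := by
    refine tendsto_nhdsWithin_iff.2 ⟨?_, Eventually.of_forall hmem⟩
    have := hline.continuousAt.tendsto
    simpa using this
  have h2 : HasDerivAt (fun t : ℝ => F (y + t • v)) 0 0 := by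
    refine (hasDerivAt_const (0 : ℝ) c).congr_of_eventuallyEq ?_
    filter_upwards [htend (chartTarget_mem_nhdsWithin hy)] with t ht
    exact hF _ ht (by simp [h0, hv])
  exact h1.unique h2

variable [IsManifold (𝓡∂ n) ∞ M]

/-- The differential of the inverse of the chart around `p`. -/
def chartFrame (p : M) (y : Coord n) : Coord n →L[ℝ] Coord n :=
  mfderivWithin 𝓘(ℝ, Coord n) (𝓡∂ n) (extChartAt (𝓡∂ n) p).symm (halfSpace n) y

theorem contDiffWithinAt_chartRep {Y : M → V} (hY : ContMDiff (𝓡∂ n) 𝓘(ℝ, V) ∞ Y) {p : M}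
    {y : Coord n} (hy : y ∈ chartTarget p) :
    ContDiffWithinAt ℝ ∞ (chartRep Y p) (halfSpace n) y := by
  have h1 : ContMDiffWithinAt 𝓘(ℝ, Coord n) (𝓡∂ n) ∞ (extChartAt (𝓡∂ n) p).symm (chartTarget p) y :=
    contMDiffOn_extChartAt_symm p y hy
  have h2 : ContMDiffWithinAt 𝓘(ℝ, Coord n) 𝓘(ℝ, V) ∞ (chartRep Y p) (chartTarget p) y :=
    (hY _).comp_contMDiffWithinAt y h1
  exact (contMDiffWithinAt_iff_contDiffWithinAt.1 h2).mono_of_mem_nhdsWithin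
    (chartTarget_mem_nhdsWithin hy)

theorem contDiffWithinAt_chartDiff {Y : M → V} (hY : ContMDiff (𝓡∂ n) 𝓘(ℝ, V) ∞ Y) {p : M}
    {y : Coord n} (hy : y ∈ chartTarget p) :
    ContDiffWithinAt ℝ ∞ (chartDiff Y p) (halfSpace n) y :=
  (contDiffWithinAt_chartRep hY hy).fderivWithin_right uniqueDiffOn_halfSpace (by simp)
    (chartTarget_subset p hy)

theorem hasFDerivWithinAt_chartRep {Y : M → V} (hY : ContMDiff (𝓡∂ n) 𝓘(ℝ, V) ∞ Y) {p : M}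
    {y : Coord n} (hy : y ∈ chartTarget p) :
    HasFDerivWithinAt (chartRep Y p) (chartDiff Y p y) (halfSpace n) y :=
  ((contDiffWithinAt_chartRep hY hy).differentiableWithinAt (by simp)).hasFDerivWithinAt

theorem chartFrame_isInvertible {p : M} {y : Coord n} (hy : y ∈ chartTarget p) :
    (chartFrame p y).IsInvertible := by
  have : IsManifold (𝓡∂ n) 1 M := IsManifold.of_le (m := 1) (n := ∞) (by simp)
  exact isInvertible_mfderivWithin_extChartAt_symm hy

theorem chartDiff_eq {Y : M → V} (hY : ContMDiff (𝓡∂ n) 𝓘(ℝ, V) ∞ Y) {p : M}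
    {y : Coord n} (hy : y ∈ chartTarget p) (v : Coord n) :
    chartDiff Y p y v =
      mfderiv (𝓡∂ n) 𝓘(ℝ, V) Y ((extChartAt (𝓡∂ n) p).symm y) (chartFrame p y v) := by
  have : IsManifold (𝓡∂ n) 1 M := IsManifold.of_le (m := 1) (n := ∞) (by simp)
  have h1 := mfderiv_comp_mfderivWithin (g := Y) (f := (extChartAt (𝓡∂ n) p).symm)
    (s := halfSpace n) (I := 𝓘(ℝ, Coord n)) (I' := 𝓡∂ n) (I'' := 𝓘(ℝ, V)) y
    (hY.mdifferentiable (by simp) _) (mdifferentiableWithinAt_extChartAt_symm hy)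
    (uniqueDiffOn_halfSpace y (chartTarget_subset p hy)).uniqueMDiffWithinAt
  rw [mfderivWithin_eq_fderivWithin] at h1
  exact congrArg (fun l : Coord n →L[ℝ] V => l v) h1

theorem eq_fderivWithin_of_eventuallyEq_const {F : Coord n → ℝ} {F' : Coord n →L[ℝ] ℝ}
    {y : Coord n} (hy : y ∈ halfSpace n) {c : ℝ} (h : HasFDerivWithinAt F F' (halfSpace n) y)
    (hF : ∀ᶠ z in 𝓝[halfSpace n] y, F z = c) : F' = 0 := by
  have h1 : HasFDerivWithinAt F (0 : Coord n →L[ℝ] ℝ) (halfSpace n) y :=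
    (hasFDerivWithinAt_const c y _).congr_of_eventuallyEq hF (hF.self_of_nhdsWithin hy)
  exact (uniqueDiffOn_halfSpace y hy).eq h h1

namespace IsHypersurface

variable {x ν : M → Mink n}

theorem adapted_chart (h : IsHypersurface x ν) {p : M} {y : Coord n} (hy : y ∈ chartTarget p) :
    IsAdapted (chartRep x p y) (chartRep ν p y) (chartDiff x p y) := by
  obtain ⟨L, hL⟩ := chartFrame_isInvertible hy
  have h1 : chartDiff x p y =
      mdiff x ((extChartAt (𝓡∂ n) p).symm y) ∘L (L : Coord n →L[ℝ] Coord n) := by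
    rw [hL]
    ext1 v
    exact chartDiff_eq h.smooth_x hy v
  rw [h1]
  exact (h.adapted _).comp L

/-- Differentiating `⟨x, ν⟩ = 0`, `⟨ν, ν⟩ = 1` and `⟨ν, dx⟩ = 0` shows that `dν` is tangential and
that the second fundamental form is symmetric. -/
theorem adapted₂_chart (h : IsHypersurface x ν) {p : M} {y : Coord n} (hy : y ∈ chartTarget p) :
    IsAdapted₂ (chartRep x p y) (chartRep ν p y) (chartDiff x p y) (chartDiff ν p y) := by
  have hys := chartTarget_subset p hy
  have hA := h.adapted_chart hy
  have hx := hasFDerivWithinAt_chartRep h.smooth_x hy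
  have hν := hasFDerivWithinAt_chartRep h.smooth_ν hy
  have hB := ((contDiffWithinAt_chartDiff h.smooth_x hy).differentiableWithinAt
    (by simp)).hasFDerivWithinAt
  have hev : ∀ᶠ z in 𝓝[halfSpace n] y,
      IsAdapted (chartRep x p z) (chartRep ν p z) (chartDiff x p z) := by
    filter_upwards [chartTarget_mem_nhdsWithin hy] with z hz using h.adapted_chart hz
  have h1 := eq_fderivWithin_of_eventuallyEq_const hys (hasFDerivWithinAt_lor hx hν)
    (hev.mono fun z hz => hz.lor_xν)
  have h2 := eq_fderivWithin_of_eventuallyEq_const hys (hasFDerivWithinAt_lor hν hν)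
    (hev.mono fun z hz => hz.lor_ν)
  refine ⟨hA, fun v => ?_, fun v => ?_, fun v w => ?_⟩
  · have h3 := congrArg (fun l : Coord n →L[ℝ] ℝ => l v) h1
    simpa [lor_comm _ (chartRep ν p y), hA.lor_νB] using h3
  · have h3 := congrArg (fun l : Coord n →L[ℝ] ℝ => l v) h2
    simp only [add_apply, ContinuousLinearMap.comp_apply, ContinuousLinearMap.flip_apply,
      zero_apply] at h3
    rw [lor_comm _ (chartRep ν p y)] at h3
    linarith
  · have hsymm : IsSymmSndFDerivWithinAt ℝ (chartRep x p) (halfSpace n) y :=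
      (contDiffWithinAt_chartRep h.smooth_x hy).isSymmSndFDerivWithinAt
        (by simp only [minSmoothness_of_isRCLikeNormedField]; exact WithTop.coe_le_coe.2 le_top)
        uniqueDiffOn_halfSpace (halfSpace_subset_closure hys) hys
    have key : ∀ v w : Coord n, lor (chartDiff ν p y v) (chartDiff x p y w) =
        -lor (chartRep ν p y) (fderivWithin ℝ (chartDiff x p) (halfSpace n) y v w) := by
      intro v w
      have hBw : HasFDerivWithinAt (fun z => chartDiff x p z w)
          ((fderivWithin ℝ (chartDiff x p) (halfSpace n) y).flip w) (halfSpace n) y := by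
        have := hB.clm_apply (hasFDerivWithinAt_const w y (halfSpace n))
        simpa using this
      have h3 := eq_fderivWithin_of_eventuallyEq_const hys (hasFDerivWithinAt_lor hν hBw)
        (hev.mono fun z hz => hz.lor_νB w)
      have h4 := congrArg (fun l : Coord n →L[ℝ] ℝ => l v) h3
      simp only [add_apply, ContinuousLinearMap.comp_apply, ContinuousLinearMap.flip_apply,
        zero_apply] at h4
      linarith
    have h5 : fderivWithin ℝ (chartDiff x p) (halfSpace n) y v w =
        fderivWithin ℝ (chartDiff x p) (halfSpace n) y w v := hsymm.eq v w
    rw [key v w, h5, ← key w v, lor_comm]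

theorem adapted₂ (h : IsHypersurface x ν) (p : M) :
    IsAdapted₂ (x p) (ν p) (mdiff x p) (mdiff ν p) := by
  have h1 := h.adapted₂_chart (mem_extChartAt_target (I := 𝓡∂ n) p)
  have hd : ∀ Y : M → Mink n, ContMDiff (𝓡∂ n) 𝓘(ℝ, Mink n) ∞ Y →
      chartDiff Y p (extChartAt (𝓡∂ n) p p) = mdiff Y p := by
    intro Y hY
    exact (MDifferentiableAt.mfderiv (hY.mdifferentiable (by simp) p)).symm
  have hr : ∀ Y : M → Mink n, chartRep Y p (extChartAt (𝓡∂ n) p p) = Y p := by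
    intro Y
    simp only [chartRep, extChartAt_to_inv]
  rwa [hd _ h.smooth_x, hd _ h.smooth_ν, hr, hr] at h1

end IsHypersurface

/-- A hypersurface of the hyperboloid that meets the hyperplane orthogonal to `sideVec` along its
boundary, at the constant angle `θ`. -/
structure IsCapillaryHypersurface (x ν : M → Mink n) (θ : ℝ) : Prop extends IsHypersurface x ν where
  angle_mem : θ ∈ Ioo 0 Real.pi
  boundary_x : ∀ p ∈ (𝓡∂ n).boundary M, lor (x p) (sideVec n) = 0
  boundary_ν : ∀ p ∈ (𝓡∂ n).boundary M, lor (ν p) (sideVec n) = Real.cos θ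

theorem mem_boundary_of_chart {p : M} {y : Coord n} (hy : y ∈ chartTarget p) (h0 : y 0 = 0) :
    (extChartAt (𝓡∂ n) p).symm y ∈ (𝓡∂ n).boundary M := by
  change (𝓡∂ n).IsBoundaryPoint _
  rw [ModelWithCorners.isBoundaryPoint_iff_not_isInteriorPoint]
  intro hint
  have hsrc : (extChartAt (𝓡∂ n) p).symm y ∈ (chartAt (EuclideanHalfSpace n) p).source := by
    rw [← extChartAt_source (𝓡∂ n)]
    exact (extChartAt (𝓡∂ n) p).map_target hy
  have h1 := ((𝓡∂ n).isInteriorPoint_iff_of_mem_atlas (n := ∞) (by simp)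
    (chart_mem_atlas _ p) hsrc).1 hint
  have h2 : extChartAt (𝓡∂ n) p ((extChartAt (𝓡∂ n) p).symm y) ∈ interior (halfSpace n) :=
    interior_mono (chartTarget_subset p) h1
  rw [(extChartAt (𝓡∂ n) p).right_inv hy, interior_halfSpace_eq] at h2
  exact h2.ne' h0

/-- The flow field in the chart around `p`. -/
def chartFlow (θ H : ℝ) (x ν : M → Mink n) (p : M) (y : Coord n) : Coord n :=
  flowField θ H (chartRep x p y) (chartRep ν p y) (chartDiff x p y) (chartDiff ν p y)

/-- The flow field of a capillary hypersurface is tangent to the boundary. -/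
theorem IsCapillaryHypersurface.chartFlow_boundary {x ν : M → Mink n} {θ : ℝ}
    (h : IsCapillaryHypersurface x ν θ) (H : ℝ) {p : M} {y : Coord n} (hy : y ∈ chartTarget p)
    (h0 : y 0 = 0) : chartFlow θ H x ν p y 0 = 0 := by
  have hA := h.adapted₂_chart hy
  have hx := hasFDerivWithinAt_chartRep h.smooth_x hy
  have hν := hasFDerivWithinAt_chartRep h.smooth_ν hy
  have hconst := hasFDerivWithinAt_const (𝕜 := ℝ) (E := Coord n) (sideVec n) y (halfSpace n)
  have hxs : lor (chartRep x p y) (sideVec n) = 0 := h.boundary_x _ (mem_boundary_of_chart hy h0)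
  have hνs : lor (chartRep ν p y) (sideVec n) = Real.cos θ :=
    h.boundary_ν _ (mem_boundary_of_chart hy h0)
  have hdx : ∀ v : Coord n, v 0 = 0 → lor (chartDiff x p y v) (sideVec n) = 0 := by
    intro v hv
    have := fderivWithin_eq_zero_of_boundary_const hy h0 (hasFDerivWithinAt_lor hx hconst)
      (fun z hz hz0 => h.boundary_x _ (mem_boundary_of_chart hz hz0)) hv
    simpa using this
  have hdν : ∀ v : Coord n, v 0 = 0 → lor (chartDiff ν p y v) (sideVec n) = 0 := by
    intro v hv
    have := fderivWithin_eq_zero_of_boundary_const hy h0 (hasFDerivWithinAt_lor hν hconst)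
      (fun z hz hz0 => h.boundary_ν _ (mem_boundary_of_chart hz hz0)) hv
    simpa using this
  rw [chartFlow]
  generalize chartRep x p y = x₀ at *
  generalize chartRep ν p y = ν₀ at *
  generalize chartDiff x p y = B at *
  generalize chartDiff ν p y = C at *
  -- the gradient of `⟨x, sideVec⟩` does not vanish, since the contact angle is neither `0` nor `π`
  set Q := tangProj x₀ ν₀ B (sideVec n) with hQ
  have hBQ : B Q = sideVec n - Real.cos θ • ν₀ := by
    rw [hQ, hA.B_tangProj, hxs, hνs]; simp
  have hQs : lor (B Q) (sideVec n) ≠ 0 := by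
    rw [hBQ]
    simp only [map_sub, map_smul, sub_apply, smul_apply, smul_eq_mul, lor_sideVec_self, hνs]
    have h1 := Real.sin_pos_of_pos_of_lt_pi h.angle_mem.1 h.angle_mem.2
    have h2 := Real.sin_sq_add_cos_sq θ
    nlinarith [pow_pos h1 2]
  have hker : ∀ v : Coord n, lor (B v) (sideVec n) = 0 → v 0 = 0 := by
    intro v hv
    set w : Coord n := Q 0 • v - v 0 • Q
    have hw : w 0 = 0 := by simp [w, mul_comm]
    have h1 := hdx w hw
    simp only [w, map_sub, map_smul, sub_apply, smul_apply, smul_eq_mul, hv, mul_zero,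
      zero_sub, neg_eq_zero] at h1
    exact (mul_eq_zero.1 h1).resolve_right hQs
  have hT : lor (B (capField θ x₀ ν₀ B)) (sideVec n) = 0 := by
    have h1 : lor (B (capField θ x₀ ν₀ B)) (sideVec n) = lor (B Q) (capVec θ ν₀) := by
      rw [capField, ← hA.lor_B_tangProj, lor_comm, hA.lor_B_tangProj]
    rw [h1, hBQ, map_sub, map_smul, sub_apply, smul_apply, lor_ν_capVec, capVec, map_add, map_smul,
      map_smul, lor_sideVec_self, lor_comm (sideVec n) (timeVec n),
      lor_timeVec_sideVec]
    simp
  apply hker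
  have h2 : flowField θ H x₀ ν₀ B C = shape x₀ ν₀ B C (capField θ x₀ ν₀ B) -
      H • capField θ x₀ ν₀ B := rfl
  rw [h2, map_sub, map_smul, hA.B_shape, map_sub, map_smul, sub_apply, smul_apply, hT,
    hdν _ (hker _ hT)]
  simp

end Chart


/-! ### Integration over the hypersurface -/

section Integration

variable {n : ℕ} [NeZero n] {M : Type*} [TopologicalSpace M]
  [ChartedSpace (EuclideanHalfSpace n) M]

/-- The volume density in the chart around `p`. -/
def chartDensity (x ν : M → Mink n) (p : M) (y : Coord n) : ℝ :=
  density (chartRep x p y) (chartRep ν p y) (chartDiff x p y)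

/-- The integral of `σ` over the domain of the chart around `p`, with respect to the volume of the
hypersurface. -/
def chartIntegral (x ν : M → Mink n) (p : M) (σ : M → ℝ) : ℝ :=
  ∫ y in chartTarget p, chartDensity x ν p y * chartRep σ p y

theorem continuousOn_chartRep {Y : Type*} [TopologicalSpace Y] {σ : M → Y} {p : M}
    (hσ : Continuous σ) :
    ContinuousOn (fun y : Coord n => σ ((extChartAt (𝓡∂ n) p).symm y)) (chartTarget p) :=
  hσ.comp_continuousOn (continuousOn_extChartAt_symm p)

/-- A continuous function on the chart target that vanishes off a closed subset of the half-space
extends by zero to a continuous function on the half-space. -/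
theorem continuousOn_indicator_target {V : Type*} [TopologicalSpace V] [Zero V]
    {p : M} {K : Set (Coord n)} (hK : IsClosed K) (hKt : K ⊆ chartTarget p) {h : Coord n → V}
    (hc : ContinuousOn h (chartTarget p)) (h0 : ∀ y ∈ chartTarget p, y ∉ K → h y = 0) :
    ContinuousOn (indicator (chartTarget p) h) (halfSpace n) := by
  intro y hy
  by_cases hyK : y ∈ K
  · have h1 : ContinuousWithinAt h (halfSpace n) y :=
      (hc y (hKt hyK)).mono_of_mem_nhdsWithin (chartTarget_mem_nhdsWithin (hKt hyK))
    refine h1.congr_of_eventuallyEq ?_ (indicator_of_mem (hKt hyK) h)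
    filter_upwards [chartTarget_mem_nhdsWithin (hKt hyK)] with z hz
    exact indicator_of_mem hz h
  · have h1 : ∀ z ∉ K, indicator (chartTarget p) h z = 0 := by
      intro z hz
      by_cases hzt : z ∈ chartTarget p
      · rw [indicator_of_mem hzt, h0 z hzt hz]
      · exact indicator_of_notMem hzt h
    refine (continuousWithinAt_const (b := (0 : V))).congr_of_eventuallyEq ?_ (h1 y hyK)
    filter_upwards [mem_nhdsWithin_of_mem_nhds (hK.isOpen_compl.mem_nhds hyK)] with z hz
    exact h1 z hz

/-- The image in the chart of the support of a function supported in the chart domain. -/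
def chartSupport (p : M) (f : M → ℝ) : Set (Coord n) := extChartAt (𝓡∂ n) p '' tsupport f

theorem isCompact_chartSupport [CompactSpace M] {p : M} {f : M → ℝ}
    (hf : tsupport f ⊆ (extChartAt (𝓡∂ n) p).source) : IsCompact (chartSupport (n := n) p f) :=
  (isClosed_tsupport f).isCompact.image_of_continuousOn ((continuousOn_extChartAt p).mono hf)

theorem chartSupport_subset {p : M} {f : M → ℝ}
    (hf : tsupport f ⊆ (extChartAt (𝓡∂ n) p).source) :
    chartSupport (n := n) p f ⊆ chartTarget p := by
  rintro _ ⟨q, hq, rfl⟩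
  exact (extChartAt (𝓡∂ n) p).map_source (hf hq)

theorem notMem_tsupport_of_notMem_chartSupport {p : M} {f : M → ℝ} {y : Coord n}
    (hy : y ∈ chartTarget p) (h : y ∉ chartSupport p f) :
    (extChartAt (𝓡∂ n) p).symm y ∉ tsupport f := fun h1 =>
  h ⟨_, h1, (extChartAt (𝓡∂ n) p).right_inv hy⟩

theorem continuous_of_chartRep {σ : M → ℝ}
    (h : ∀ p, ∀ y ∈ chartTarget (n := n) p, ContinuousWithinAt (chartRep σ p) (halfSpace n) y) :
    Continuous σ := by
  rw [continuous_iff_continuousAt]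
  intro p
  have h1 := h p _ (mem_extChartAt_target (I := 𝓡∂ n) p)
  have h2 : ContinuousAt (chartRep (n := n) σ p ∘ extChartAt (𝓡∂ n) p) p :=
    (continuousWithinAt_univ _ _).1 (h1.comp (continuousAt_extChartAt p).continuousWithinAt
      (fun q _ => mem_range_self _))
  refine h2.congr ?_
  filter_upwards [extChartAt_source_mem_nhds (I := 𝓡∂ n) p] with q hq
  simp only [Function.comp, chartRep, (extChartAt (𝓡∂ n) p).left_inv hq]

variable [IsManifold (𝓡∂ n) ∞ M] {x ν : M → Mink n}

namespace IsHypersurface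

theorem continuousOn_chartDensity (h : IsHypersurface x ν) (p : M) :
    ContinuousOn (chartDensity x ν p) (chartTarget p) := fun _ hy =>
  (continuousWithinAt_density (contDiffWithinAt_chartRep h.smooth_x hy)
    (contDiffWithinAt_chartRep h.smooth_ν hy)
    (contDiffWithinAt_chartDiff h.smooth_x hy)).mono (chartTarget_subset p)

theorem chartDensity_pos (h : IsHypersurface x ν) {p : M} {y : Coord n}
    (hy : y ∈ chartTarget p) : 0 < chartDensity x ν p y :=
  density_pos (h.adapted_chart hy).isInvertible

theorem integrableOn_chart [CompactSpace M] (h : IsHypersurface x ν) {p : M} {f σ : M → ℝ}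
    (hf : tsupport f ⊆ (extChartAt (𝓡∂ n) p).source) (hσ : Continuous σ)
    (h0 : ∀ q ∉ tsupport f, σ q = 0) :
    IntegrableOn (fun y => chartDensity x ν p y * chartRep σ p y) (chartTarget p) := by
  have hK := isCompact_chartSupport hf
  have hsub := chartSupport_subset hf
  have h1 : ContinuousOn (fun y => chartDensity x ν p y * chartRep σ p y) (chartTarget p) :=
    (h.continuousOn_chartDensity p).mul (continuousOn_chartRep hσ)
  refine ((h1.mono hsub).integrableOn_compact hK).of_forall_sdiff_eq_zero
    (measurableSet_chartTarget p) ?_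
  rintro y ⟨hy, hyK⟩
  rw [chartRep, h0 _ (notMem_tsupport_of_notMem_chartSupport hy hyK), mul_zero]

/-- The integral of a function supported in two chart domains can be computed in either. -/
theorem chartIntegral_eq (h : IsHypersurface x ν) {p p' : M} {σ : M → ℝ}
    (h0 : ∀ q, σ q ≠ 0 → q ∈ (extChartAt (𝓡∂ n) p).source ∧ q ∈ (extChartAt (𝓡∂ n) p').source) :
    chartIntegral x ν p σ = chartIntegral x ν p' σ := by
  set e := extChartAt (𝓡∂ n) p with he
  set e' := extChartAt (𝓡∂ n) p' with he'
  set s : Set (Coord n) := e.target ∩ e.symm ⁻¹' e'.source with hs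
  set Ψ : Coord n → Coord n := e' ∘ e.symm with hΨ
  have hsrc_open : IsOpen e'.source := isOpen_extChartAt_source p'
  have hsnhds : ∀ y ∈ s, s ∈ 𝓝[halfSpace n] y := by
    intro y hy
    have h1 : ContinuousWithinAt e.symm (halfSpace n) y :=
      (continuousOn_extChartAt_symm p y hy.1).mono_of_mem_nhdsWithin
        (chartTarget_mem_nhdsWithin hy.1)
    exact inter_mem (chartTarget_mem_nhdsWithin hy.1)
      (h1 (hsrc_open.mem_nhds hy.2))
  have hmeas : ∀ (p p' : M), MeasurableSet ((extChartAt (𝓡∂ n) p).target ∩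
      (extChartAt (𝓡∂ n) p).symm ⁻¹' (extChartAt (𝓡∂ n) p').source) := by
    intro p p'
    obtain ⟨U, hU, hUe⟩ := (continuousOn_iff'.1 (continuousOn_extChartAt_symm (I := 𝓡∂ n) p))
      _ (isOpen_extChartAt_source (I := 𝓡∂ n) p')
    rw [inter_comm, hUe]
    exact hU.measurableSet.inter (measurableSet_chartTarget p)
  have himage : Ψ '' s = e'.target ∩ e'.symm ⁻¹' e.source := by
    ext z
    constructor
    · rintro ⟨y, hy, rfl⟩
      refine ⟨e'.map_source hy.2, ?_⟩
      simp only [hΨ, Function.comp, mem_preimage, e'.left_inv hy.2]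
      exact e.map_target hy.1
    · rintro ⟨hz, hz2⟩
      refine ⟨e (e'.symm z), ⟨e.map_source hz2, ?_⟩, ?_⟩
      · simp only [mem_preimage, e.left_inv hz2]
        exact e'.map_target hz
      · simp only [hΨ, Function.comp, e.left_inv hz2, e'.right_inv hz]
  have hinj : InjOn Ψ s := by
    intro y hy z hz hyz
    have h1 : e.symm y = e.symm z := e'.injOn hy.2 hz.2 hyz
    exact e.symm.injOn hy.1 hz.1 h1
  have hΨd : ∀ y ∈ s, HasFDerivWithinAt Ψ (fderivWithin ℝ Ψ (halfSpace n) y) (halfSpace n) y := by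
    intro y hy
    have h1 : ContDiffWithinAt ℝ ∞ Ψ (halfSpace n) y := by
      have h2 := contDiffWithinAt_ext_coord_change (I := 𝓡∂ n) (n := ∞) p' p
        (y := y) ⟨hy.1, hy.2⟩
      exact h2
    exact (h1.differentiableWithinAt (by simp)).hasFDerivWithinAt
  -- the densities transform with the Jacobian of the transition map `Ψ`
  have hdens : ∀ y ∈ s, chartDensity x ν p y =
      |(fderivWithin ℝ Ψ (halfSpace n) y).det| * chartDensity x ν p' (Ψ y) := by
    intro y hy
    have hyt : Ψ y ∈ chartTarget p' := e'.map_source hy.2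
    have hrep : ∀ Y : M → Mink n, ∀ z ∈ s, chartRep Y p z = chartRep Y p' (Ψ z) := by
      intro Y z hz
      simp only [chartRep, hΨ, Function.comp, ← he, ← he', e'.left_inv hz.2]
    have hdiff : chartDiff x p y =
        chartDiff x p' (Ψ y) ∘L fderivWithin ℝ Ψ (halfSpace n) y := by
      have h1 : HasFDerivWithinAt (fun z => chartRep x p' (Ψ z))
          (chartDiff x p' (Ψ y) ∘L fderivWithin ℝ Ψ (halfSpace n) y) (halfSpace n) y :=
        (hasFDerivWithinAt_chartRep h.smooth_x hyt).comp y (hΨd y hy)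
          (fun z _ => mem_range_self _)
      have h2 : HasFDerivWithinAt (chartRep x p)
          (chartDiff x p' (Ψ y) ∘L fderivWithin ℝ Ψ (halfSpace n) y) (halfSpace n) y := by
        refine h1.congr_of_eventuallyEq ?_ (hrep x y hy)
        filter_upwards [hsnhds y hy] with z hz using hrep x z hz
      exact (uniqueDiffOn_halfSpace y (chartTarget_subset p hy.1)).eq
        (hasFDerivWithinAt_chartRep h.smooth_x hy.1) h2
    rw [chartDensity, hdiff, hrep x y hy, hrep ν y hy, density_comp, chartDensity]
  have hrestrict : ∀ (p p' : M) (hσ : ∀ q, σ q ≠ 0 → q ∈ (extChartAt (𝓡∂ n) p').source),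
      chartIntegral x ν p σ = ∫ y in (extChartAt (𝓡∂ n) p).target ∩
        (extChartAt (𝓡∂ n) p).symm ⁻¹' (extChartAt (𝓡∂ n) p').source,
          chartDensity x ν p y * chartRep σ p y := by
    intro p p' hσ
    rw [chartIntegral]
    refine setIntegral_eq_of_subset_of_forall_sdiff_eq_zero (measurableSet_chartTarget p)
      inter_subset_left ?_
    rintro y ⟨hy, hy2⟩
    by_contra hne
    exact hy2 ⟨hy, hσ _ (right_ne_zero_of_mul hne)⟩
  rw [hrestrict p p' fun q hq => (h0 q hq).2, hrestrict p' p fun q hq => (h0 q hq).1]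
  have hcv := integral_image_eq_integral_abs_det_fderiv_smul volume (hmeas p p')
    (fun y hy => (hΨd y hy).mono (fun z hz => chartTarget_subset p hz.1)) hinj
    (fun y => chartDensity x ν p' y * chartRep σ p' y)
  rw [himage] at hcv
  rw [hcv]
  refine setIntegral_congr_fun (hmeas p p') fun y hy => ?_
  have hrep : chartRep σ p y = chartRep σ p' (Ψ y) := by
    have hy' : e.symm y ∈ e'.source := hy.2
    simp only [chartRep, hΨ, Function.comp, ← he, ← he', e'.left_inv hy']
  simp only [smul_eq_mul]
  rw [hdens y hy, hrep]
  ring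

/-- A nonnegative function with vanishing integral is zero almost everywhere in the chart, hence
everywhere by continuity, as boundary points are limits of interior points. -/
theorem eq_zero_of_chartIntegral_eq_zero [CompactSpace M] (h : IsHypersurface x ν) {p : M}
    {f σ : M → ℝ} (hf : tsupport f ⊆ (extChartAt (𝓡∂ n) p).source) (hσ : Continuous σ)
    (h0 : ∀ q ∉ tsupport f, σ q = 0) (hnn : ∀ q, 0 ≤ σ q) (hint : chartIntegral x ν p σ = 0)
    (q : M) : σ q = 0 := by
  by_cases hq : q ∈ tsupport f
  swap
  · exact h0 q hq
  have h1 := (setIntegral_eq_zero_iff_of_nonneg_ae (by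
    filter_upwards [ae_restrict_mem (measurableSet_chartTarget p)] with y hy
    exact mul_nonneg (h.chartDensity_pos hy).le (hnn _)) (h.integrableOn_chart hf hσ h0)).1 hint
  have h2 := Measure.eqOn_of_ae_eq h1
    ((h.continuousOn_chartDensity p).mul (continuousOn_chartRep hσ)) continuousOn_const
    (chartTarget_subset_closure p)
  have hqs := hf hq
  have h3 := h2 ((extChartAt (𝓡∂ n) p).map_source hqs)
  have h4 := (mul_eq_zero.1 h3).resolve_left
    (h.chartDensity_pos ((extChartAt (𝓡∂ n) p).map_source hqs)).ne'
  rwa [chartRep, (extChartAt (𝓡∂ n) p).left_inv hqs] at h4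

end IsHypersurface

end Integration


/-! ### The integral formula and rigidity -/

section Rigidity

variable {n : ℕ} [NeZero n] {M : Type*} [TopologicalSpace M]
  [ChartedSpace (EuclideanHalfSpace n) M]

/-- The flow field on the hypersurface. -/
def flow (θ H : ℝ) (x ν : M → Mink n) (q : M) : Coord n :=
  flowField θ H (x q) (ν q) (mdiff x q) (mdiff ν q)

/-- The density `u |A - H|²` whose integral vanishes, where `u` is the time component of `ν`. -/
def defect (H : ℝ) (x ν : M → Mink n) (q : M) : ℝ :=
  (ν q).1 * umbilicity H (x q) (ν q) (mdiff x q) (mdiff ν q)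

/-- The derivative of `f` in the direction of the flow field. -/
def flowDeriv (θ H : ℝ) (x ν : M → Mink n) (f : M → ℝ) (q : M) : ℝ :=
  (mfderiv (𝓡∂ n) 𝓘(ℝ, ℝ) f q : Coord n →L[ℝ] ℝ) (flow θ H x ν q)

variable [IsManifold (𝓡∂ n) ∞ M] {x ν : M → Mink n} {θ H : ℝ}

theorem exists_chartFrame_equiv {p : M} {y : Coord n} (hy : y ∈ chartTarget p) :
    ∃ L : Coord n ≃L[ℝ] Coord n, (∀ v, L v = chartFrame p y v) ∧
      ∀ Y : M → Mink n, ContMDiff (𝓡∂ n) 𝓘(ℝ, Mink n) ∞ Y → chartDiff Y p y =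
        mdiff Y ((extChartAt (𝓡∂ n) p).symm y) ∘L (L : Coord n →L[ℝ] Coord n) := by
  obtain ⟨L, hL⟩ := chartFrame_isInvertible hy
  refine ⟨L, fun v => by rw [← hL]; rfl, fun Y hY => ?_⟩
  rw [hL]
  ext1 v
  exact chartDiff_eq hY hy v

namespace IsHypersurface

theorem traceL_shape_chart (h : IsHypersurface x ν)
    (hH : ∀ q, traceL _ (shape (x q) (ν q) (mdiff x q) (mdiff ν q)) = n * H) {p : M}
    {y : Coord n} (hy : y ∈ chartTarget p) :
    traceL _ (shape (chartRep x p y) (chartRep ν p y) (chartDiff x p y) (chartDiff ν p y)) =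
      n * H := by
  obtain ⟨L, -, hL⟩ := exists_chartFrame_equiv hy
  rw [hL x h.smooth_x, hL ν h.smooth_ν, ← hH ((extChartAt (𝓡∂ n) p).symm y)]
  exact traceL_shape_comp L (h.adapted _).isInvertible

theorem chartRep_defect (h : IsHypersurface x ν) {p : M} {y : Coord n} (hy : y ∈ chartTarget p) :
    chartRep (defect H x ν) p y = (chartRep ν p y).1 *
      umbilicity H (chartRep x p y) (chartRep ν p y) (chartDiff x p y) (chartDiff ν p y) := by
  obtain ⟨L, -, hL⟩ := exists_chartFrame_equiv hy
  rw [hL x h.smooth_x, hL ν h.smooth_ν]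
  exact congrArg _ (umbilicity_comp L H (h.adapted _).isInvertible).symm

theorem chartRep_flowDeriv (h : IsHypersurface x ν) {f : M → ℝ}
    (hf : ContMDiff (𝓡∂ n) 𝓘(ℝ, ℝ) ∞ f) {p : M} {y : Coord n} (hy : y ∈ chartTarget p) :
    chartRep (flowDeriv θ H x ν f) p y = chartDiff f p y (chartFlow θ H x ν p y) := by
  obtain ⟨L, hLv, hL⟩ := exists_chartFrame_equiv hy
  rw [chartDiff_eq hf hy, ← hLv, chartFlow, hL x h.smooth_x, hL ν h.smooth_ν]
  have h1 := flowField_comp (C := mdiff ν ((extChartAt (𝓡∂ n) p).symm y)) L θ H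
    (h.adapted ((extChartAt (𝓡∂ n) p).symm y)).isInvertible
  have h2 : L (flowField θ H (chartRep x p y) (chartRep ν p y)
      (mdiff x ((extChartAt (𝓡∂ n) p).symm y) ∘L (L : Coord n →L[ℝ] Coord n))
      (mdiff ν ((extChartAt (𝓡∂ n) p).symm y) ∘L (L : Coord n →L[ℝ] Coord n))) =
      flow θ H x ν ((extChartAt (𝓡∂ n) p).symm y) := by
    refine (congrArg L h1).trans ?_
    rw [L.apply_symm_apply]
    rfl
  rw [h2]
  rfl

theorem continuousWithinAt_chartFlow (h : IsHypersurface x ν) {p : M} {y : Coord n}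
    (hy : y ∈ chartTarget p) :
    ContinuousWithinAt (chartFlow θ H x ν p) (halfSpace n) y :=
  (contDiffWithinAt_flowField θ H (contDiffWithinAt_chartRep h.smooth_x hy)
    (contDiffWithinAt_chartRep h.smooth_ν hy) (contDiffWithinAt_chartDiff h.smooth_x hy)
    (contDiffWithinAt_chartDiff h.smooth_ν hy)
    (h.adapted_chart hy).isInvertible).continuousWithinAt

theorem continuous_defect (h : IsHypersurface x ν) : Continuous (defect H x ν) := by
  refine continuous_of_chartRep (n := n) fun p y hy => ?_
  have h1 := (contDiffWithinAt_umbilicity H (contDiffWithinAt_chartRep h.smooth_x hy)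
    (contDiffWithinAt_chartRep h.smooth_ν hy) (contDiffWithinAt_chartDiff h.smooth_x hy)
    (contDiffWithinAt_chartDiff h.smooth_ν hy)
    (h.adapted_chart hy).isInvertible).continuousWithinAt
  have h2 := (contDiffWithinAt_chartRep h.smooth_ν hy).continuousWithinAt
  refine (h2.fst.mul h1).congr_of_eventuallyEq ?_ (h.chartRep_defect hy)
  filter_upwards [chartTarget_mem_nhdsWithin hy] with z hz using h.chartRep_defect hz

theorem continuous_flowDeriv (h : IsHypersurface x ν) {f : M → ℝ}
    (hf : ContMDiff (𝓡∂ n) 𝓘(ℝ, ℝ) ∞ f) : Continuous (flowDeriv θ H x ν f) := by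
  refine continuous_of_chartRep (n := n) fun p y hy => ?_
  have h1 := (contDiffWithinAt_chartDiff hf hy).continuousWithinAt
  refine (h1.clm_apply (h.continuousWithinAt_chartFlow hy)).congr_of_eventuallyEq ?_
    (h.chartRep_flowDeriv hf hy)
  filter_upwards [chartTarget_mem_nhdsWithin hy] with z hz using h.chartRep_flowDeriv hf hz

omit [IsManifold (𝓡∂ n) ∞ M] in
theorem flowDeriv_of_notMem_tsupport {f : M → ℝ} {q : M} (hq : q ∉ tsupport f) :
    flowDeriv θ H x ν f q = 0 := by
  have h1 : f =ᶠ[𝓝 q] fun _ => (0 : ℝ) := notMem_tsupport_iff_eventuallyEq.1 hq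
  rw [flowDeriv, h1.mfderiv_eq, mfderiv_const]
  rfl

/-- The divergence of `ρ f W` in a chart, at an interior point. -/
theorem divergence_chart (h : IsHypersurface x ν)
    (hH : ∀ q, traceL _ (shape (x q) (ν q) (mdiff x q) (mdiff ν q)) = n * H) {f : M → ℝ}
    (hf : ContMDiff (𝓡∂ n) 𝓘(ℝ, ℝ) ∞ f) {p : M} {y : Coord n} (hy : y ∈ chartTarget p)
    (hy0 : 0 < y 0) :
    DifferentiableAt ℝ (fun z => (chartDensity x ν p z * chartRep f p z) •
      chartFlow θ H x ν p z) y ∧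
    traceL _ (fderiv ℝ (fun z => (chartDensity x ν p z * chartRep f p z) •
      chartFlow θ H x ν p z) y) = chartDensity x ν p y *
        chartRep (fun q => flowDeriv θ H x ν f q - f q * defect H x ν q) p y := by
  have hs : halfSpace n ∈ 𝓝 y := by
    rw [mem_nhds_iff]
    exact ⟨interior (halfSpace n), interior_subset, isOpen_interior, by
      rw [interior_halfSpace_eq]; exact hy0⟩
  have ht : chartTarget p ∈ 𝓝 y := by
    have := chartTarget_mem_nhdsWithin hy
    rwa [nhdsWithin_eq_nhds.2 hs] at this
  have hBs := (contDiffWithinAt_chartDiff h.smooth_x hy).contDiffAt hs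
  have hCs := (contDiffWithinAt_chartDiff h.smooth_ν hy).contDiffAt hs
  have hsymm : ∀ Y : M → Mink n, ContMDiff (𝓡∂ n) 𝓘(ℝ, Mink n) ∞ Y → ∀ v w,
      fderiv ℝ (chartDiff Y p) y v w = fderiv ℝ (chartDiff Y p) y w v := by
    intro Y hY v w
    have h1 : IsSymmSndFDerivWithinAt ℝ (chartRep Y p) (halfSpace n) y :=
      (contDiffWithinAt_chartRep hY hy).isSymmSndFDerivWithinAt
        (by simp only [minSmoothness_of_isRCLikeNormedField]; exact WithTop.coe_le_coe.2 le_top)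
        uniqueDiffOn_halfSpace (halfSpace_subset_closure (chartTarget_subset p hy))
        (chartTarget_subset p hy)
    have h2 := h1.eq v w
    rwa [fderivWithin_of_mem_nhds hs] at h2
  have key := divergence_flowField (θ := θ) (H := H)
    (((contDiffWithinAt_chartRep h.smooth_x hy).contDiffAt hs).of_le (by simp))
    (((contDiffWithinAt_chartRep h.smooth_ν hy).contDiffAt hs).of_le (by simp))
    (hBs.of_le (by simp)) (hCs.of_le (by simp))
    ((hasFDerivWithinAt_chartRep h.smooth_x hy).hasFDerivAt hs)
    ((hasFDerivWithinAt_chartRep h.smooth_ν hy).hasFDerivAt hs)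
    (hBs.differentiableAt (by simp)).hasFDerivAt (hCs.differentiableAt (by simp)).hasFDerivAt
    (hsymm x h.smooth_x) (hsymm ν h.smooth_ν)
    (by filter_upwards [ht] with z hz using h.adapted₂_chart hz)
    (by filter_upwards [ht] with z hz using h.traceL_shape_chart hH hz)
    ((hasFDerivWithinAt_chartRep hf hy).hasFDerivAt hs).differentiableAt
  refine ⟨key.1, key.2.trans ?_⟩
  have h3 : fderiv ℝ (chartRep f p) y = chartDiff f p y :=
    ((hasFDerivWithinAt_chartRep hf hy).hasFDerivAt hs).fderiv
  have h4 : chartRep (fun q => flowDeriv θ H x ν f q - f q * defect H x ν q) p y =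
      chartRep (flowDeriv θ H x ν f) p y - chartRep f p y * chartRep (defect H x ν) p y := rfl
  rw [h4, h.chartRep_flowDeriv hf hy, h.chartRep_defect hy, h3]
  rfl

end IsHypersurface

variable [CompactSpace M]

/-- The divergence theorem for `f W`, where `f` is supported in a chart domain. -/
theorem IsCapillaryHypersurface.chartIntegral_flow (h : IsCapillaryHypersurface x ν θ)
    (hH : ∀ q, traceL _ (shape (x q) (ν q) (mdiff x q) (mdiff ν q)) = n * H) {f : M → ℝ}
    (hf : ContMDiff (𝓡∂ n) 𝓘(ℝ, ℝ) ∞ f) {p : M}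
    (hfp : tsupport f ⊆ (extChartAt (𝓡∂ n) p).source) :
    chartIntegral x ν p (fun q => flowDeriv θ H x ν f q - f q * defect H x ν q) = 0 := by
  set σ : M → ℝ := fun q => flowDeriv θ H x ν f q - f q * defect H x ν q with hσ
  have hσc : Continuous σ :=
    (h.continuous_flowDeriv hf).sub (hf.continuous.mul h.continuous_defect)
  have hσ0 : ∀ q ∉ tsupport f, σ q = 0 := by
    intro q hq
    simp only [hσ, IsHypersurface.flowDeriv_of_notMem_tsupport hq,
      image_eq_zero_of_notMem_tsupport hq]
    simp
  have hK := isCompact_chartSupport hfp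
  have hsub := chartSupport_subset hfp
  set W : Coord n → Coord n := fun z => (chartDensity x ν p z * chartRep f p z) •
    chartFlow θ H x ν p z with hW
  set g : Coord n → ℝ := fun z => chartDensity x ν p z * chartRep σ p z with hg
  have hWc : ContinuousOn W (chartTarget p) :=
    ((h.continuousOn_chartDensity p).mul (continuousOn_chartRep hf.continuous)).smul
      fun y hy => (h.continuousWithinAt_chartFlow hy).mono (chartTarget_subset p)
  have hgc : ContinuousOn g (chartTarget p) :=
    (h.continuousOn_chartDensity p).mul (continuousOn_chartRep hσc)
  have hWK : ∀ y ∈ chartTarget p, y ∉ chartSupport p f → W y = 0 := by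
    intro y hy hyK
    simp only [hW, chartRep, image_eq_zero_of_notMem_tsupport
      (notMem_tsupport_of_notMem_chartSupport hy hyK), mul_zero, zero_smul]
  have hgK : ∀ y ∈ chartTarget p, y ∉ chartSupport p f → g y = 0 := by
    intro y hy hyK
    simp only [hg, chartRep, hσ0 _ (notMem_tsupport_of_notMem_chartSupport hy hyK), mul_zero]
  have hoff : ∀ {V : Type} [Zero V] (k : Coord n → V),
      (∀ y ∈ chartTarget p, y ∉ chartSupport p f → k y = 0) →
      ∀ y ∉ chartSupport p f, indicator (chartTarget p) k y = 0 := by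
    intro V _ k hk y hy
    by_cases hyt : y ∈ chartTarget p
    · rw [indicator_of_mem hyt, hk y hyt hy]
    · exact indicator_of_notMem hyt k
  have hdiff : ∀ y : Coord n, 0 < y 0 →
      DifferentiableAt ℝ (indicator (chartTarget p) W) y ∧
      traceL _ (fderiv ℝ (indicator (chartTarget p) W) y) = indicator (chartTarget p) g y := by
    intro y hy0
    by_cases hyt : y ∈ chartTarget p
    · have hs : halfSpace n ∈ 𝓝 y := by
        rw [mem_nhds_iff]
        exact ⟨interior (halfSpace n), interior_subset, isOpen_interior, by
          rw [interior_halfSpace_eq]; exact hy0⟩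
      have ht : chartTarget p ∈ 𝓝 y := by
        have := chartTarget_mem_nhdsWithin hyt
        rwa [nhdsWithin_eq_nhds.2 hs] at this
      have hev : indicator (chartTarget p) W =ᶠ[𝓝 y] W := by
        filter_upwards [ht] with z hz using indicator_of_mem hz W
      obtain ⟨h1, h2⟩ := h.divergence_chart (θ := θ) hH hf hyt hy0
      exact ⟨hev.differentiableAt_iff.2 h1, by
        rw [hev.fderiv_eq, indicator_of_mem hyt]; exact h2⟩
    · have hyK : y ∉ chartSupport p f := fun hk => hyt (hsub hk)
      have hev : indicator (chartTarget p) W =ᶠ[𝓝 y] fun _ => (0 : Coord n) := by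
        filter_upwards [hK.isClosed.isOpen_compl.mem_nhds hyK] with z hz using hoff W hWK z hz
      refine ⟨hev.differentiableAt_iff.2 (differentiableAt_const _), ?_⟩
      rw [hev.fderiv_eq, indicator_of_notMem hyt]
      simp
  have key := integral_divergence_halfSpace hK
    (by rw [← halfSpace_eq]; exact continuousOn_indicator_target hK.isClosed hsub hWc hWK)
    (by rw [← halfSpace_eq]; exact continuousOn_indicator_target hK.isClosed hsub hgc hgK)
    (hoff W hWK) (hoff g hgK)
    (fun y hy0 => by
      by_cases hyt : y ∈ chartTarget p
      · rw [indicator_of_mem hyt]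
        simp [hW, h.chartFlow_boundary H hyt hy0]
      · rw [indicator_of_notMem hyt]
        rfl)
    (fun y hy => (hdiff y hy).1) (fun y hy => (hdiff y hy).2)
  rw [← halfSpace_eq, setIntegral_indicator (measurableSet_chartTarget p),
    inter_eq_self_of_subset_right (chartTarget_subset p)] at key
  exact key

variable [T2Space M]

/-- A compact capillary hypersurface of constant mean curvature for which the time component of the
normal is positive has vanishing traceless second fundamental form. -/
theorem IsCapillaryHypersurface.traceless_eq_zero (h : IsCapillaryHypersurface x ν θ)
    (hH : ∀ q, traceL _ (shape (x q) (ν q) (mdiff x q) (mdiff ν q)) = n * H)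
    (hpos : ∀ q, 0 < (ν q).1) (q : M) :
    traceless H (x q) (ν q) (mdiff x q) (mdiff ν q) = 0 := by
  have hdef_nonneg : ∀ q, 0 ≤ defect H x ν q := fun q =>
    mul_nonneg (hpos q).le ((h.adapted₂ q).umbilicity_nonneg H)
  suffices hdef : defect H x ν q = 0 by
    exact (h.adapted₂ q).traceless_eq_zero ((mul_eq_zero.1 hdef).resolve_left (hpos q).ne')
  obtain ⟨t, ht⟩ := CompactSpace.elim_nhds_subcover
    (fun p : M => (extChartAt (𝓡∂ n) p).source) (fun p => extChartAt_source_mem_nhds p)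
  obtain ⟨f, hf⟩ := SmoothPartitionOfUnity.exists_isSubordinate (𝓡∂ n) isClosed_univ
    (fun i : t => (extChartAt (𝓡∂ n) (i : M)).source)
    (fun i => isOpen_extChartAt_source (i : M)) (by
      rw [← top_eq_univ, ← ht]
      exact iUnion₂_subset fun p hp => subset_iUnion_of_subset ⟨p, hp⟩ subset_rfl)
  have hsum : ∀ q, ∑ i, f i q = 1 := by
    intro q
    have := f.sum_eq_one (mem_univ q)
    rwa [finsum_eq_sum_of_fintype] at this
  have hfs : ∀ i, ContMDiff (𝓡∂ n) 𝓘(ℝ, ℝ) ∞ (f i) := fun i => (f i).contMDiff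
  set σ : t → M → ℝ := fun i q => flowDeriv θ H x ν (f i) q - f i q * defect H x ν q with hσ
  have hσc : ∀ i, Continuous (σ i) := fun i =>
    (h.continuous_flowDeriv (hfs i)).sub ((hfs i).continuous.mul h.continuous_defect)
  have hσ0 : ∀ i, ∀ q ∉ tsupport (f i), σ i q = 0 := by
    intro i q hq
    simp only [hσ, IsHypersurface.flowDeriv_of_notMem_tsupport hq,
      image_eq_zero_of_notMem_tsupport hq]
    simp
  -- the derivatives of the partition functions add up to zero
  have hσsum : ∀ q, ∑ i, σ i q = -defect H x ν q := by
    intro q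
    have h1 : ∑ i, flowDeriv θ H x ν (f i) q = 0 := by
      have h2 : HasMFDerivAt (𝓡∂ n) 𝓘(ℝ, ℝ) (fun q => ∑ i, f i q) q
          (∑ i, mfderiv (𝓡∂ n) 𝓘(ℝ, ℝ) (f i) q : Coord n →L[ℝ] ℝ) :=
        ⟨continuous_finsetSum _ (fun i _ => (hfs i).continuous) |>.continuousAt,
          HasFDerivWithinAt.fun_sum fun i _ =>
            ((hfs i).mdifferentiable (by simp) q).hasMFDerivAt.2⟩
      have h3 : (fun q => ∑ i, f i q) = fun _ => (1 : ℝ) := funext hsum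
      rw [h3] at h2
      have h4 := h2.mfderiv
      rw [mfderiv_const] at h4
      have h5 := congrArg (fun l : Coord n →L[ℝ] ℝ => l (flow θ H x ν q)) h4
      have h6 : ∀ (F : t → Coord n →L[ℝ] ℝ) (v : Coord n), ∑ i, F i v = (∑ i, F i) v :=
        fun F v => by simp
      exact (h6 _ _).trans h5.symm
    simp only [hσ, Finset.sum_sub_distrib, h1, ← Finset.sum_mul, hsum]
    ring
  have hintg : ∀ (j : t) (τ : M → ℝ), Continuous τ →
      IntegrableOn (fun y => chartDensity x ν (j : M) y * chartRep (fun q => f j q * τ q) (j : M) y)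
        (chartTarget (j : M)) := fun j τ hτ =>
    h.integrableOn_chart (hf j) ((hfs j).continuous.mul hτ) fun q hq => by
      rw [image_eq_zero_of_notMem_tsupport hq, zero_mul]
  -- each integral is split by the partition of unity, and the pieces are regrouped by chart
  have hsplit : ∀ i : t, chartIntegral x ν (i : M) (σ i) =
      ∑ j : t, chartIntegral x ν (j : M) (fun q => f j q * σ i q) := by
    intro i
    have h1 : ∀ j : t, chartIntegral x ν (j : M) (fun q => f j q * σ i q) =
        chartIntegral x ν (i : M) (fun q => f j q * σ i q) := by
      intro j
      refine h.chartIntegral_eq fun q hq => ⟨hf j ?_, hf i ?_⟩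
      · by_contra hq'
        exact hq (by rw [image_eq_zero_of_notMem_tsupport hq', zero_mul])
      · by_contra hq'
        exact hq (by rw [hσ0 i q hq', mul_zero])
    simp only [h1]
    simp only [chartIntegral]
    rw [← integral_finsetSum]
    · refine integral_congr_ae (Eventually.of_forall fun y => ?_)
      simp only [chartRep, ← Finset.mul_sum, ← Finset.sum_mul, hsum, one_mul]
    · intro j _
      refine h.integrableOn_chart (hf i) ((hfs j).continuous.mul (hσc i)) fun q hq => ?_
      rw [hσ0 i q hq, mul_zero]
  have htotal : ∑ j : t, chartIntegral x ν (j : M) (fun q => f j q * defect H x ν q) = 0 := by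
    have h1 : ∑ i : t, chartIntegral x ν (i : M) (σ i) = 0 :=
      Finset.sum_eq_zero fun i _ => h.chartIntegral_flow hH (hfs i) (hf i)
    simp only [hsplit] at h1
    rw [Finset.sum_comm] at h1
    rw [← neg_eq_zero, ← h1, ← Finset.sum_neg_distrib]
    refine Finset.sum_congr rfl fun j _ => ?_
    simp only [chartIntegral]
    rw [← integral_finsetSum _ fun i _ => hintg j (σ i) (hσc i), ← integral_neg]
    refine integral_congr_ae (Eventually.of_forall fun y => ?_)
    simp only [chartRep, ← Finset.mul_sum, hσsum]
    ring
  have hnn : ∀ (j : t) q, 0 ≤ f j q * defect H x ν q := fun j q =>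
    mul_nonneg (f.nonneg j q) (hdef_nonneg q)
  have heach := (Finset.sum_eq_zero_iff_of_nonneg fun (j : t) _ =>
    setIntegral_nonneg (measurableSet_chartTarget (j : M)) fun y hy =>
      mul_nonneg (h.chartDensity_pos hy).le (hnn j _)).1 htotal
  have hzero : ∀ (j : t), f j q * defect H x ν q = 0 := fun j =>
    h.eq_zero_of_chartIntegral_eq_zero (σ := fun q => f j q * defect H x ν q) (hf j)
      ((hfs j).continuous.mul h.continuous_defect)
      (fun q hq => by rw [image_eq_zero_of_notMem_tsupport hq, zero_mul]) (hnn j)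
      (heach j (Finset.mem_univ j)) q
  rw [← one_mul (defect H x ν q), ← hsum q, Finset.sum_mul]
  exact Finset.sum_eq_zero fun j _ => hzero j

end Rigidity


/-! ### Capillary hypersurfaces of the half ball -/

section HalfBall

variable {n : ℕ}

theorem apply_eq_sum_single (l : Coord n →L[ℝ] ℝ) (v : Coord n) :
    l v = ∑ i, v i * l (EuclideanSpace.single i 1) := by
  conv_lhs => rw [← (EuclideanSpace.basisFun (Fin n) ℝ).sum_repr v]
  simp

/-- The trace of the shape operator in terms of the two fundamental forms. -/
theorem IsAdapted₂.trace_inv_mul {x ν : Mink n} {B C : Coord n →L[ℝ] Mink n}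
    (h : IsAdapted₂ x ν B C) :
    Matrix.trace ((Matrix.of fun i j : Fin n =>
        lor (B (EuclideanSpace.single i 1)) (B (EuclideanSpace.single j 1)))⁻¹ *
      (Matrix.of fun i j : Fin n =>
        lor (C (EuclideanSpace.single i 1)) (B (EuclideanSpace.single j 1)))) =
      traceL _ (shape x ν B C) := by
  set G : Matrix (Fin n) (Fin n) ℝ := Matrix.of fun i j =>
    lor (B (EuclideanSpace.single i 1)) (B (EuclideanSpace.single j 1)) with hG
  have hdet : IsUnit G.det := by
    rw [isUnit_iff_ne_zero]
    intro h0
    obtain ⟨c, hc, hGc⟩ := Matrix.exists_mulVec_eq_zero_iff.2 h0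
    set v : Coord n := WithLp.toLp 2 c
    have hv : v ≠ 0 := fun hv => hc (by simpa [v] using congrArg WithLp.ofLp hv)
    refine (h.lor_B_pos hv).ne' ?_
    have h1 : ∀ i, lor (B v) (B (EuclideanSpace.single i 1)) = 0 := by
      intro i
      rw [lor_comm]
      refine (apply_eq_sum_single (lor (B (EuclideanSpace.single i 1)) ∘L B) v).trans ?_
      refine Eq.trans ?_ (congrFun hGc i)
      simp [Matrix.mulVec, dotProduct, hG, v, mul_comm]
    refine (apply_eq_sum_single (lor (B v) ∘L B) v).trans (Finset.sum_eq_zero fun i _ => ?_)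
    rw [ContinuousLinearMap.comp_apply, h1, mul_zero]
  have hprod : (Matrix.of fun i j : Fin n =>
      lor (C (EuclideanSpace.single i 1)) (B (EuclideanSpace.single j 1))) =
      (Matrix.of fun i k => shape x ν B C (EuclideanSpace.single i 1) k) * G := by
    ext i j
    rw [Matrix.of_apply, ← h.B_shape, Matrix.mul_apply]
    exact apply_eq_sum_single (lor.flip (B (EuclideanSpace.single j 1)) ∘L B) _
  rw [hprod, Matrix.trace_mul_comm, Matrix.mul_assoc, Matrix.mul_nonsing_inv _ hdet,
    Matrix.mul_one, traceL_euclidean]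
  rfl

theorem IsAdapted₂.lor_C_eq_of_traceless_eq_zero {x ν : Mink n} {B C : Coord n →L[ℝ] Mink n}
    {H : ℝ} (h : IsAdapted₂ x ν B C) (h0 : traceless H x ν B C = 0) (v w : Coord n) :
    lor (C v) (B w) = H * lor (B v) (B w) := by
  have h1 : shape x ν B C v = H • v := by
    rw [traceless, sub_eq_zero] at h0
    simp [h0]
  rw [← h.B_shape, h1, map_smul, map_smul]
  rfl

variable [NeZero n] {M : Type*} [TopologicalSpace M] [ChartedSpace (EuclideanHalfSpace n) M]
  {X ν : M → Amb n} {θ : ℝ}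

theorem inducedMetric_eq_lor (hX : IsImmersedInHalfBall X) (p : M) (v w : Coord n) :
    inducedMetric X p v w = lor (mdiff (fun q => hypLift (X q)) p v)
      (mdiff (fun q => hypLift (X q)) p w) := by
  rw [mdiff_hypLift hX, mdiff_hypLift hX, lor_vecLift (hX.mem_halfBall p).1]
  rfl

theorem secondFundamentalForm_eq_lor (hX : IsImmersedInHalfBall X) (hν : IsUnitNormal X ν) (p : M)
    (v w : Coord n) :
    secondFundamentalForm X ν p v w = lor (mdiff (fun q => vecLift (X q) (ν q)) p v)
      (mdiff (fun q => hypLift (X q)) p w) := by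
  rw [mdiff_vecLift hX hν, mdiff_hypLift hX, lor_vecLift (hX.mem_halfBall p).1]
  rfl

theorem isCapillaryHypersurface_lift (hX : IsImmersedInHalfBall X) (hν : IsUnitNormal X ν)
    (hcap : IsCapillary X ν θ) :
    IsCapillaryHypersurface (fun q => hypLift (X q)) (fun q => vecLift (X q) (ν q)) θ where
  toIsHypersurface := isHypersurface_lift hX hν
  angle_mem := hcap.angle_mem
  boundary_x p hp := by
    simp [lor_apply, hypLift, sideVec, inner_smul_left, (hcap.map_boundary p hp).2]
  boundary_ν p hp := by
    obtain ⟨hx, hxs⟩ := hcap.map_boundary p hp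
    have h0 := one_sub_norm_sq_ne hx
    rw [← hcap.contact_angle p hp]
    simp only [lor_apply, vecLift, sideVec, hypMetric, supportNormal, inner_add_left,
      inner_smul_left, inner_neg_right, RCLike.conj_to_real, hxs, real_inner_comm (ν p) (lastVec n)]
    field_simp
    ring

variable [IsManifold (𝓡∂ n) ∞ M]

theorem traceL_shape_lift (hX : IsImmersedInHalfBall X) (hν : IsUnitNormal X ν) (p : M) :
    traceL _ (shape (hypLift (X p)) (vecLift (X p) (ν p)) (mdiff (fun q => hypLift (X q)) p)
      (mdiff (fun q => vecLift (X q) (ν q)) p)) = n * meanCurvature X ν p := by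
  have hn : (n : ℝ) ≠ 0 := Nat.cast_ne_zero.2 (NeZero.ne n)
  rw [← ((isHypersurface_lift hX hν).adapted₂ p).trace_inv_mul, meanCurvature, ← mul_assoc,
    mul_one_div_cancel hn, one_mul]
  congr 2
  · congr 1
    ext i j
    exact (inducedMetric_eq_lor hX p _ _).symm
  · ext i j
    exact (secondFundamentalForm_eq_lor hX hν p _ _).symm

theorem isTotallyUmbilical_of_isCapillary [T2Space M] [CompactSpace M]
    (hX : IsImmersedInHalfBall X) (hν : IsUnitNormal X ν) (hcap : IsCapillary X ν θ)
    (hcmc : IsCMC X ν) (hstar : IsStarShaped X ν) : IsTotallyUmbilical X ν := by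
  obtain ⟨H, hH⟩ := hcmc
  have h := isCapillaryHypersurface_lift hX hν hcap
  have key := h.traceless_eq_zero (H := H)
    (fun q => by rw [traceL_shape_lift hX hν, hH]) (fun q => by
      have h1 : (vecLift (X q) (ν q)).1 = hypMetric (X q) (X q) (ν q) := by
        simp only [vecLift, hypMetric, div_eq_mul_inv, inv_pow]
        ring
      rw [h1]
      exact hstar q)
  intro p
  refine ⟨H, fun v w => ?_⟩
  refine (secondFundamentalForm_eq_lor hX hν p v w).trans ?_
  refine Eq.trans ?_ (congrArg (H * ·) (inducedMetric_eq_lor hX p v w).symm)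
  exact (h.adapted₂ p).lor_C_eq_of_traceless_eq_zero (key p) v w

end HalfBall

end HyperbolicCapillary

end

end

theorem theorem1p6 {n : ℕ} [NeZero n] {M : Type*} [TopologicalSpace M]
    [ChartedSpace (EuclideanHalfSpace n) M] [IsManifold (𝓡∂ n) ∞ M] [T2Space M] [CompactSpace M]
    (X ν : M → HyperbolicCapillary.Amb n) (θ : ℝ)
    (hX : HyperbolicCapillary.IsImmersedInHalfBall X)
    (hν : HyperbolicCapillary.IsUnitNormal X ν)
    (hcap : HyperbolicCapillary.IsCapillary X ν θ)
    (hcmc : HyperbolicCapillary.IsCMC X ν)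
    (hstar : HyperbolicCapillary.IsStarShaped X ν) :
    HyperbolicCapillary.IsTotallyUmbilical X ν := by
  exact HyperbolicCapillary.isTotallyUmbilical_of_isCapillary hX hν hcap hcmc hstar
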